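/- Let $d\ge 2$, let $\mu$ be a finitely supported probability measure on $SL_d(\mathbb Z)$, and let $\Gamma\subseteq SL_d(\mathbb Z)$ be the sub-semigroup generated by the support of $\mu$. Assume that $\Gamma$ is strongly irreducible, i.e. that its action on $\mathbb R^d$ preserves no finite (nonempty) union of proper nonzero linear subspaces. Let $\chi:\Gamma\to\mathbb R$ be a semigroup morphism ($\chi(gh)=\chi(g)+\chi(h)$) such that $\chi_\star\mu$ is centered, i.e. $\sum_g\mu(g)\chi(g)=0$. Let $\Gamma$ act on $\mathbb T^d\times\mathbb R$, where $\mathbb T^d=\mathbb R^d/\mathbb Z^d$, by $g.(x,t)=(gx,t+\chi(g))$. A Radon measure $\nu$ on $\mathbb T^d\times\mathbb R$ (a Borel measure that is finite on compact sets) is called $\mu$-stationary if $\nu=\sum_g\mu(g)\,g_\star\nu$, and a $\mu$-stationary Radon measure $\nu$ is called ergodic if it is nonzero and generates an extremal ray of the convex cone of $\mu$-stationary Radon measures: whenever $\nu=\nu_1+\nu_2$ with $\nu_1,\nu_2$ $\mu$-stationary Radon measures, both $\nu_1$ and $\nu_2$ are multiples of $\nu$. A uniform measure on a set $S$ is a measure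 $c\sum_{s\in S}\delta_s$ with $0<c<\infty$. Let $\nu$ be an ergodic $\mu$-stationary Radon measure on $\mathbb T^d\times\mathbb R$, and let $x\in\mathbb T^d$ be such that $\nu(\{x\}\times\mathbb R)\in\,]0,+\infty]$. Then $x$ is rational, i.e. $x\in\mathbb Q^d/\mathbb Z^d$, and its orbit $\omega:=\Gamma x\subseteq\mathbb T^d$ is finite. Moreover $\chi(\Gamma)\subseteq\mathbb R$ is either discrete or dense, and: 1. If $\chi(\Gamma)$ is discrete, then $\nu$ is a uniform measure on a $\Gamma$-orbit $\Gamma p$, $p\in\mathbb T^d\times\mathbb R$, contained in $\omega\times(\chi(\Gamma)+t)$ for some $t\in\mathbb R$. 2. If $\chi(\Gamma)$ is dense in $\mathbb R$, then $\nu=\nu_\omega\otimes\mathrm{leb}$, where $\nu_\omega$ is a (finite) uniform measure on $\omega$ and $\mathrm{leb}$ is Lebesgue measure on $\mathbb R$. -/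

import Mathlib

open MeasureTheory Matrix
open scoped ENNReal NNReal

namespace TorusWalk

/-- The sub-semigroup `Γ` of `SL_d(ℤ)` generated by the support of the probability `μ`. -/
def semigroup {d : ℕ} (μ : PMF (SpecialLinearGroup (Fin d) ℤ)) :
    Subsemigroup (SpecialLinearGroup (Fin d) ℤ) :=
  Subsemigroup.closure μ.support

/-- An element of the support of `μ`, seen as an element of `Γ`. -/
def gen {d : ℕ} (μ : PMF (SpecialLinearGroup (Fin d) ℤ)) (g : μ.support) : semigroup μ :=
  ⟨g, Subsemigroup.subset_closure g.2⟩

/-- The linear action of `SL_d(ℤ)` on `ℝ^d`. -/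
def linAct {d : ℕ} (g : SpecialLinearGroup (Fin d) ℤ) (v : Fin d → ℝ) : Fin d → ℝ :=
  (g : Matrix (Fin d) (Fin d) ℤ).map (Int.cast : ℤ → ℝ) *ᵥ v

/-- The action of `SL_d(ℤ)` on the torus `𝕋^d = (ℝ/ℤ)^d`. -/
def torusAct {d : ℕ} (g : SpecialLinearGroup (Fin d) ℤ) (x : UnitAddTorus (Fin d)) :
    UnitAddTorus (Fin d) :=
  fun i => ∑ j, (g : Matrix (Fin d) (Fin d) ℤ) i j • x j

/-- The action of `Γ` on `𝕋^d × ℝ`, given by `g.(x, t) = (g x, t + χ(g))`. -/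
def act {d : ℕ} {Γ : Subsemigroup (SpecialLinearGroup (Fin d) ℤ)} (χ : Γ → ℝ) (g : Γ)
    (p : UnitAddTorus (Fin d) × ℝ) : UnitAddTorus (Fin d) × ℝ :=
  (torusAct g p.1, p.2 + χ g)

/-- Strong irreducibility: no finite (nonempty) union of proper nonzero subspaces of `ℝ^d` is
preserved by `Γ`. -/
def StronglyIrreducible {d : ℕ} (Γ : Subsemigroup (SpecialLinearGroup (Fin d) ℤ)) : Prop :=
  ¬ ∃ S : Set (Submodule ℝ (Fin d → ℝ)), S.Finite ∧ S.Nonempty ∧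
      (∀ V ∈ S, V ≠ ⊥ ∧ V ≠ ⊤) ∧
      ∀ g ∈ Γ, Set.MapsTo (linAct g) (⋃ V ∈ S, (V : Set (Fin d → ℝ)))
        (⋃ V ∈ S, (V : Set (Fin d → ℝ)))

/-- The image probability `χ_* μ` on `ℝ` has a first moment and mean zero. -/
def Centered {d : ℕ} (μ : PMF (SpecialLinearGroup (Fin d) ℤ)) (χ : semigroup μ → ℝ) : Prop :=
  HasSum (fun g : μ.support => (μ g).toReal * χ (gen μ g)) 0

/-- `ν` is a `μ`-stationary Radon measure on `𝕋^d × ℝ`: it is finite on compact sets and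
`ν = ∑_g μ(g) g_* ν`. -/
structure IsStationaryRadon {d : ℕ} (μ : PMF (SpecialLinearGroup (Fin d) ℤ))
    (χ : semigroup μ → ℝ) (ν : Measure (UnitAddTorus (Fin d) × ℝ)) : Prop where
  radon : IsFiniteMeasureOnCompacts ν
  stationary : ν = Measure.sum fun g : μ.support => μ g • ν.map (act χ (gen μ g))

/-- `ν` is ergodic: it generates an extremal ray of the convex cone of `μ`-stationary Radon
measures on `𝕋^d × ℝ`. -/
structure IsErgodicStationary {d : ℕ} (μ : PMF (SpecialLinearGroup (Fin d) ℤ))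
    (χ : semigroup μ → ℝ) (ν : Measure (UnitAddTorus (Fin d) × ℝ)) : Prop extends
    IsStationaryRadon μ χ ν where
  ne_zero : ν ≠ 0
  extremal : ∀ ν₁ ν₂ : Measure (UnitAddTorus (Fin d) × ℝ),
    IsStationaryRadon μ χ ν₁ → IsStationaryRadon μ χ ν₂ → ν = ν₁ + ν₂ →
      (∃ c : ℝ≥0, ν₁ = c • ν) ∧ ∃ c : ℝ≥0, ν₂ = c • ν

/-- A point of the torus is rational if it lies in `ℚ^d / ℤ^d`. -/
def IsRationalPoint {d : ℕ} (x : UnitAddTorus (Fin d)) : Prop :=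
  ∃ q : Fin d → ℚ, ∀ i, x i = ((q i : ℝ) : UnitAddCircle)

/-- The orbit `Γ x` in `𝕋^d`. -/
def torusOrbit {d : ℕ} (Γ : Subsemigroup (SpecialLinearGroup (Fin d) ℤ))
    (x : UnitAddTorus (Fin d)) : Set (UnitAddTorus (Fin d)) :=
  {y | ∃ g ∈ Γ, y = torusAct g x}

/-- The orbit `Γ p` in `𝕋^d × ℝ`. -/
def orbit {d : ℕ} {Γ : Subsemigroup (SpecialLinearGroup (Fin d) ℤ)} (χ : Γ → ℝ)
    (p : UnitAddTorus (Fin d) × ℝ) : Set (UnitAddTorus (Fin d) × ℝ) :=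
  Set.range fun g : Γ => act χ g p

/-- `m` is a uniform measure on the set `S`: `m = c ∑_{s ∈ S} δ_s` for some `0 < c < ∞`. -/
def IsUniformOn {X : Type*} [MeasurableSpace X] (m : Measure X) (S : Set X) : Prop :=
  ∃ c : ℝ≥0, 0 < c ∧ m = c • Measure.sum fun s : S => Measure.dirac (s : X)

end TorusWalk

/-!
The proof rests on an elementary rigidity property of centered random walks on the line: a
nonnegative continuous superharmonic function `f` is harmonic (`harmonic_of_superharmonic`). Indeed
a second antiderivative `N` of `f` is convex, so `∑ i, p i * N (t - a i) - N t` is nonnegative by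
Jensen's inequality and concave by superharmonicity, hence constant.

For a point `y` of the torus let `ν_y` be the part of `ν` carried by `{y} × ℝ`. Smoothing the `ν_y`
by a test function gives functions `F y t ≥ 0`, summable in `y`, which are harmonic for the walk.
Then `∑ y, log (1 + F y t)` is superharmonic, hence harmonic, and the equality case of Jensen's
inequality shows that `ν_{g y}` is the translate of `ν_y` by `χ g`, for all `g` in the semigroup
(`fiber_torusAct`).

If `ν_x ≠ 0`, then the points `g x` with `|χ g| ≤ R` are finite in number, since only finitely many
fibres give a definite mass to a given compact interval. If `x` were not rational, a homomorphism
from the circle to the line would turn them into the images `g v` of a nonzero vector `v`. Orbits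
of nonzero vectors span `ℝ^d`, so only finitely many `g` would satisfy `|χ g| ≤ R`. Then, up to
finitely many left factors, the semigroup would consist of the powers of a single element `c`, and
an invariant subspace of `c` would contradict strong irreducibility
(`not_proper_character`, `isRationalPoint_of_atom`).

So `x` is rational, its orbit `ω` is finite and permuted by the semigroup, and by ergodicity `ν` is
carried by `ω × ℝ`. The values of `χ` form a dense set or a discrete group
(`range_character_dense_or_zmultiples`). In the dense case the fibres have a dense set of
periods and are multiples of Lebesgue measure (`eq_prod_volume`). In the discrete case ergodicity
confines the second coordinate to one coset of that group, so `ν` has an atom, and its orbit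
carries `ν` (`isUniformOn_orbit`).
-/

namespace TorusWalk

/-! ### Superharmonic functions of centered walks on the line -/

/-- A concave function on the whole line that is bounded below is constant; here concavity enters
through an antitone derivative. -/
lemma deriv_eq_zero_of_antitone_of_nonneg {D D' : ℝ → ℝ} (hD : ∀ t, HasDerivAt D (D' t) t)
    (hanti : Antitone D') (hpos : ∀ t, 0 ≤ D t) (t : ℝ) : D' t = 0 := by
  have hdiff : Differentiable ℝ D := fun t => (hD t).differentiableAt
  have hderiv : deriv D = D' := funext fun t => (hD t).deriv
  have hconc : ConcaveOn ℝ Set.univ D :=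
    Antitone.concaveOn_univ_of_deriv hdiff (by rwa [hderiv])
  -- the tangent at `t` dominates `D`, and a nonconstant affine function is somewhere negative
  have tangent : ∀ s, D s ≤ D t + D' t * (s - t) := by
    intro s
    rcases lt_trichotomy s t with h | h | h
    · have := hconc.le_slope_of_hasDerivAt (Set.mem_univ s) (Set.mem_univ t) h (hD t)
      rw [slope_def_field, le_div_iff₀ (by linarith)] at this
      linarith
    · simp [h]
    · have := hconc.slope_le_of_hasDerivAt (Set.mem_univ t) (Set.mem_univ s) h (hD t)
      rw [slope_def_field, div_le_iff₀ (by linarith)] at this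
      linarith
  by_contra hne
  have h1 := tangent (t - (D t + 1) / D' t)
  have h2 : D t + D' t * (t - (D t + 1) / D' t - t) = -1 := by field_simp; ring
  linarith [hpos (t - (D t + 1) / D' t)]

/-- A nonnegative continuous function that is superharmonic for a centered, finitely supported
random walk on `ℝ` is harmonic. Its second antiderivative `N` is convex, so that
`D t = ∑ i, p i * N (t - a i) - N t` is nonnegative by Jensen's inequality, while
superharmonicity says that `D` is concave. Hence `D` is constant and `D'' = 0`. -/
lemma harmonic_of_superharmonic {ι : Type*} [Fintype ι] {p a : ι → ℝ} (hp : ∀ i, 0 ≤ p i)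
    (hp1 : ∑ i, p i = 1) (hpa : ∑ i, p i * a i = 0) {f : ℝ → ℝ} (hf : Continuous f)
    (hf0 : ∀ t, 0 ≤ f t) (hsup : ∀ t, ∑ i, p i * f (t - a i) ≤ f t) (t : ℝ) :
    ∑ i, p i * f (t - a i) = f t := by
  set F : ℝ → ℝ := fun t => ∫ x in (0 : ℝ)..t, f x with hF
  have dF : ∀ t, HasDerivAt F (f t) t := fun t =>
    intervalIntegral.integral_hasDerivAt_right (hf.intervalIntegrable _ _)
      hf.aestronglyMeasurable.stronglyMeasurableAtFilter hf.continuousAt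
  have cF : Continuous F := continuous_iff_continuousAt.2 fun t => (dF t).continuousAt
  set N : ℝ → ℝ := fun t => ∫ x in (0 : ℝ)..t, F x with hN
  have dN : ∀ t, HasDerivAt N (F t) t := fun t =>
    intervalIntegral.integral_hasDerivAt_right (cF.intervalIntegrable _ _)
      cF.aestronglyMeasurable.stronglyMeasurableAtFilter cF.continuousAt
  have dsum : ∀ {G g : ℝ → ℝ}, (∀ t, HasDerivAt G (g t) t) → ∀ t,
      HasDerivAt (fun t => ∑ i, p i * G (t - a i) - G t) (∑ i, p i * g (t - a i) - g t) t := by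
    intro G g hG t
    refine HasDerivAt.sub (HasDerivAt.fun_sum fun i _ => ?_) (hG t)
    exact ((hG (t - a i)).comp_sub_const t (a i)).const_mul (p i)
  have monoF : Monotone F := monotone_of_deriv_nonneg (fun t => (dF t).differentiableAt)
    fun t => by rw [(dF t).deriv]; exact hf0 t
  have convN : ConvexOn ℝ Set.univ N := Monotone.convexOn_univ_of_deriv
    (fun t => (dN t).differentiableAt) (by rwa [funext fun t => (dN t).deriv])
  have hDpos : ∀ t, 0 ≤ ∑ i, p i * N (t - a i) - N t := by
    intro t
    have h := convN.map_sum_le (t := Finset.univ) (w := p) (p := fun i => t - a i)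
      (fun i _ => hp i) hp1 (fun i _ => Set.mem_univ _)
    have e : ∑ i, p i • (t - a i) = t := by
      simp only [smul_eq_mul, mul_sub, Finset.sum_sub_distrib, ← Finset.sum_mul, hp1, hpa]
      ring
    rw [e] at h
    simpa using h
  have hanti : Antitone fun t => ∑ i, p i * F (t - a i) - F t :=
    antitone_of_deriv_nonpos (fun t => (dsum dF t).differentiableAt) fun t => by
      rw [(dsum dF t).deriv]; linarith [hsup t]
  have hzero := deriv_eq_zero_of_antitone_of_nonneg (dsum dN) hanti hDpos
  have h2 := (dsum dF t).unique
    ((hasDerivAt_const t (0 : ℝ)).congr_of_eventuallyEq (Filter.Eventually.of_forall hzero))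
  linarith

/-- Nonnegative functions `F y` on a line, indexed by a discrete set that a finite family of
permutations `e i` acts on, summable over the set and harmonic for the centered random walk with
steps `(e i, a i)`, are invariant under every step: the superharmonic function
`∑ y, log (1 + F y t)` on `ℝ` is harmonic, which is the equality case of Jensen's inequality. -/
lemma invariant_of_harmonic {ι X : Type*} [Fintype ι] {p a : ι → ℝ} (hp : ∀ i, 0 < p i)
    (hp1 : ∑ i, p i = 1) (hpa : ∑ i, p i * a i = 0) (e : ι → X ≃ X) {F : X → ℝ → ℝ}
    (hF0 : ∀ y t, 0 ≤ F y t) (hFc : ∀ y, Continuous (F y))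
    (hFs : ∀ R : ℝ, ∃ u : X → ℝ, Summable u ∧ ∀ y t, |t| < R → F y t ≤ u y)
    (hF : ∀ y t, F y t = ∑ i, p i * F (e i y) (t - a i)) (i : ι) (y : X) (t : ℝ) :
    F (e i y) (t - a i) = F y t := by
  set f : ℝ → ℝ := fun t => ∑' y, Real.log (1 + F y t) with hf
  have log0 : ∀ y t, 0 ≤ Real.log (1 + F y t) := fun y t =>
    Real.log_nonneg (by linarith [hF0 y t])
  have logle : ∀ y t, Real.log (1 + F y t) ≤ F y t := fun y t =>
    (Real.log_le_sub_one_of_pos (by linarith [hF0 y t])).trans (by linarith)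
  have hsum : ∀ t, Summable fun y => Real.log (1 + F y t) := by
    intro t
    obtain ⟨u, hu, hFu⟩ := hFs (|t| + 1)
    exact hu.of_nonneg_of_le (fun y => log0 y t)
      fun y => (logle y t).trans (hFu y t (lt_add_one _))
  have hcont : Continuous f := by
    refine continuous_iff_continuousAt.2 fun t => ?_
    obtain ⟨u, hu, hFu⟩ := hFs (|t| + 1)
    have hopen : IsOpen {s : ℝ | |s| < |t| + 1} := isOpen_lt continuous_abs continuous_const
    refine ContinuousOn.continuousAt (s := {s : ℝ | |s| < |t| + 1}) ?_
      (hopen.mem_nhds (by simp))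
    refine continuousOn_tsum (fun y => Continuous.continuousOn ?_) hu fun y s hs => ?_
    · exact Continuous.log (continuous_const.add (hFc y)) fun s => by linarith [hF0 y s]
    · rw [Real.norm_of_nonneg (log0 y s)]
      exact (logle y s).trans (hFu y s hs)
  have hsum' : ∀ i t, Summable fun y => p i * Real.log (1 + F (e i y) (t - a i)) := fun i t =>
    (((e i).summable_iff (f := fun y => Real.log (1 + F y (t - a i)))).2 (hsum _)).mul_left _
  have heq : ∀ t, ∑ i, p i * f (t - a i)
      = ∑' y, ∑ i, p i * Real.log (1 + F (e i y) (t - a i)) := by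
    intro t
    rw [Summable.tsum_finsetSum fun i _ => hsum' i t]
    refine Finset.sum_congr rfl fun i _ => ?_
    rw [tsum_mul_left, (e i).tsum_eq fun y => Real.log (1 + F y (t - a i))]
  have hmean : ∀ y t, ∑ i, p i • (1 + F (e i y) (t - a i)) = 1 + F y t := by
    intro y t
    simp only [smul_eq_mul, mul_add, Finset.sum_add_distrib, mul_one, hp1, ← hF y t]
  have hmem : ∀ y t, ∀ i ∈ Finset.univ, 1 + F (e i y) (t - a i) ∈ Set.Ioi (0 : ℝ) :=
    fun y t i _ => by have := hF0 (e i y) (t - a i); simp only [Set.mem_Ioi]; linarith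
  have hjensen : ∀ y t, ∑ i, p i * Real.log (1 + F (e i y) (t - a i))
      ≤ Real.log (1 + F y t) := by
    intro y t
    have := strictConcaveOn_log_Ioi.concaveOn.le_map_sum (t := Finset.univ) (w := p)
      (fun i _ => (hp i).le) hp1 (hmem y t)
    rwa [hmean] at this
  have hsumR : ∀ t, Summable fun y => ∑ i, p i * Real.log (1 + F (e i y) (t - a i)) :=
    fun t => summable_sum fun i _ => hsum' i t
  have hharm := harmonic_of_superharmonic (fun i => (hp i).le) hp1 hpa hcont
    (fun t => tsum_nonneg fun y => log0 y t)
    (fun t => by rw [heq]; exact (hsumR t).tsum_le_tsum (fun y => hjensen y t) (hsum t)) t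
  rw [heq] at hharm
  have hpt : ∑ i, p i * Real.log (1 + F (e i y) (t - a i)) = Real.log (1 + F y t) := by
    by_contra hne
    exact absurd hharm (Summable.tsum_lt_tsum (fun y => hjensen y t)
      (lt_of_le_of_ne (hjensen y t) hne) (hsumR t) (hsum t)).ne
  have := (strictConcaveOn_log_Ioi.map_sum_eq_iff (t := Finset.univ) (w := p)
    (fun i _ => hp i) hp1 (hmem y t)).1 (by rw [hmean]; exact hpt.symm) i (Finset.mem_univ i)
  rw [hmean] at this
  linarith

end TorusWalk

namespace TorusWalk

/-! ### The action on the torus -/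

variable {d : ℕ}

lemma torusAct_mul (g h : SpecialLinearGroup (Fin d) ℤ) (x : UnitAddTorus (Fin d)) :
    torusAct (g * h) x = torusAct g (torusAct h x) := by
  funext i
  simp only [torusAct, Matrix.SpecialLinearGroup.coe_mul, Matrix.mul_apply, Finset.sum_smul,
    Finset.smul_sum, mul_smul]
  exact Finset.sum_comm

lemma torusAct_one (x : UnitAddTorus (Fin d)) : torusAct 1 x = x := by
  funext i
  simp [torusAct, Matrix.one_apply, ite_smul]

/-- An element of `SL_d(ℤ)` as a permutation of the torus. -/
def torusPerm (g : SpecialLinearGroup (Fin d) ℤ) : UnitAddTorus (Fin d) ≃ UnitAddTorus (Fin d) where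
  toFun := torusAct g
  invFun := torusAct g⁻¹
  left_inv x := by rw [← torusAct_mul, inv_mul_cancel, torusAct_one]
  right_inv x := by rw [← torusAct_mul, mul_inv_cancel, torusAct_one]

lemma torusAct_injective (g : SpecialLinearGroup (Fin d) ℤ) : Function.Injective (torusAct g) :=
  (torusPerm g).injective

lemma torusAct_smul (g : SpecialLinearGroup (Fin d) ℤ) (n : ℕ) (x : UnitAddTorus (Fin d)) :
    torusAct g (n • x) = n • torusAct g x := by
  funext i
  simp only [torusAct, Pi.smul_apply, Finset.smul_sum]
  exact Finset.sum_congr rfl fun j _ => smul_comm _ _ _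

lemma continuous_torusAct (g : SpecialLinearGroup (Fin d) ℤ) : Continuous (torusAct g) := by
  unfold torusAct
  fun_prop

lemma measurable_act {Γ : Subsemigroup (SpecialLinearGroup (Fin d) ℤ)} (χ : Γ → ℝ) (g : Γ) :
    Measurable (act χ g) := by
  have := continuous_torusAct (g : SpecialLinearGroup (Fin d) ℤ)
  unfold act
  exact Continuous.measurable (by fun_prop)

/-! ### Fibres of a measure on the product -/

/-- The part of `ν` carried by `{y} × ℝ`, seen as a measure on `ℝ`. -/
noncomputable def fiber (ν : Measure (UnitAddTorus (Fin d) × ℝ)) (y : UnitAddTorus (Fin d)) :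
    Measure ℝ :=
  (ν.restrict ({y} ×ˢ Set.univ)).map Prod.snd

lemma fiber_apply (ν : Measure (UnitAddTorus (Fin d) × ℝ)) (y : UnitAddTorus (Fin d))
    {B : Set ℝ} (hB : MeasurableSet B) : fiber ν y B = ν ({y} ×ˢ B) := by
  rw [fiber, Measure.map_apply measurable_snd hB,
    Measure.restrict_apply (measurable_snd hB)]
  congr 1
  ext ⟨z, t⟩
  simp [and_comm]

instance isFiniteMeasureOnCompacts_fiber (ν : Measure (UnitAddTorus (Fin d) × ℝ))
    [IsFiniteMeasureOnCompacts ν] (y : UnitAddTorus (Fin d)) :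
    IsFiniteMeasureOnCompacts (fiber ν y) where
  lt_top_of_isCompact K hK := by
    rw [fiber_apply ν y hK.measurableSet]
    exact (isCompact_singleton.prod hK).measure_lt_top

lemma tsum_fiber_le (ν : Measure (UnitAddTorus (Fin d) × ℝ)) {B : Set ℝ} (hB : MeasurableSet B) :
    ∑' y, fiber ν y B ≤ ν (Set.univ ×ˢ B) := by
  simp only [fiber_apply ν _ hB]
  refine (tsum_meas_le_meas_iUnion_of_disjoint ν (fun y => (measurableSet_singleton y).prod hB)
    fun y z hyz => ?_).trans (measure_mono ?_)
  · exact Set.disjoint_left.2 fun q hy hz => hyz (hy.1.symm.trans hz.1)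
  · exact Set.iUnion_subset fun y => Set.prod_mono_left (Set.subset_univ _)

lemma tsum_fiber_ne_top (ν : Measure (UnitAddTorus (Fin d) × ℝ)) [IsFiniteMeasureOnCompacts ν]
    {K : Set ℝ} (hK : IsCompact K) : ∑' y, fiber ν y K ≠ ∞ :=
  ((tsum_fiber_le ν hK.measurableSet).trans_lt (isCompact_univ.prod hK).measure_lt_top).ne

lemma act_preimage_prod {Γ : Subsemigroup (SpecialLinearGroup (Fin d) ℤ)} (χ : Γ → ℝ) (g : Γ)
    (y : UnitAddTorus (Fin d)) (B : Set ℝ) :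
    act χ g ⁻¹' ({y} ×ˢ B) = {(torusPerm g.1).symm y} ×ˢ ((fun s => s + χ g) ⁻¹' B) := by
  ext ⟨z, t⟩
  simp only [act, Set.mem_preimage, Set.mem_prod, Set.mem_singleton_iff]
  rw [Equiv.eq_symm_apply]
  rfl

variable {μ : PMF (SpecialLinearGroup (Fin d) ℤ)} {χ : semigroup μ → ℝ}
  {ν : Measure (UnitAddTorus (Fin d) × ℝ)}

/-- Stationarity, read on the fibres. -/
lemma fiber_stationary [Fintype μ.support] (hν : IsStationaryRadon μ χ ν)
    (y : UnitAddTorus (Fin d)) :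
    fiber ν y = ∑ g : μ.support,
      μ g • (fiber ν ((torusPerm g.1).symm y)).map (fun s => s + χ (gen μ g)) := by
  ext B hB
  rw [fiber_apply ν y hB]
  conv_lhs => rw [hν.stationary]
  rw [Measure.sum_fintype, Measure.finsetSum_apply, Measure.finsetSum_apply]
  refine Finset.sum_congr rfl fun g _ => ?_
  have hm : Measurable fun s : ℝ => s + χ (gen μ g) := measurable_id.add_const _
  rw [Measure.smul_apply, Measure.smul_apply, Measure.map_apply hm hB,
    Measure.map_apply (measurable_act χ _) ((measurableSet_singleton y).prod hB),
    act_preimage_prod, fiber_apply ν _ (hm hB)]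
  rfl

/-- Every continuous function `φ ≥ 0` with compact support has the same integral on the fibres
over `g⁻¹ y` and `y`, up to the translation by `χ g`. -/
lemma integral_fiber_step (hμ : μ.support.Finite) (hcent : Centered μ χ)
    (hν : IsStationaryRadon μ χ ν) {φ : ℝ → ℝ} (hφ : Continuous φ) (hφc : HasCompactSupport φ)
    (hφ0 : ∀ s, 0 ≤ φ s) (g : μ.support) (y : UnitAddTorus (Fin d)) (t : ℝ) :
    ∫ s, φ (-s + (t - χ (gen μ g))) ∂fiber ν ((torusPerm g.1).symm y)
      = ∫ s, φ (-s + t) ∂fiber ν y := by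
  have := hμ.fintype
  have := hν.radon
  have hp : ∀ g : μ.support, 0 < (μ g).toReal := fun g =>
    ENNReal.toReal_pos ((μ.mem_support_iff _).1 g.2) (μ.apply_ne_top _)
  have hp1 : ∑ g : μ.support, (μ g).toReal = 1 := by
    rw [← ENNReal.toReal_sum fun g _ => μ.apply_ne_top _, ← tsum_fintype (L := .unconditional _),
      tsum_subtype_eq_of_support_subset (f := fun g => μ g) (s := μ.support) (by rfl),
      μ.tsum_coe, ENNReal.toReal_one]
  have hpa : ∑ g : μ.support, (μ g).toReal * χ (gen μ g) = 0 :=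
    (hasSum_fintype _).unique hcent
  have hint : ∀ (y : UnitAddTorus (Fin d)) (t : ℝ),
      Integrable (fun s => φ (-s + t)) (fiber ν y) := fun y t =>
    Continuous.integrable_of_hasCompactSupport (by fun_prop)
      (hφc.comp_homeomorph ((Homeomorph.neg ℝ).trans (Homeomorph.addRight t)))
  refine invariant_of_harmonic hp hp1 hpa (fun g => (torusPerm g.1).symm)
    (F := fun y t => ∫ s, φ (-s + t) ∂fiber ν y)
    (fun y t => integral_nonneg fun s => hφ0 _)
    (fun y => continuous_integral_apply_neg_add hφ hφc) ?_ ?_ g y t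
  · -- on a bounded range of `t` the integrals only see a compact interval of the fibres
    intro R
    obtain ⟨C, hC⟩ := hφc.exists_bound_of_continuous hφ
    obtain ⟨r, hr⟩ := hφc.isCompact.isBounded.subset_closedBall 0
    set K : Set ℝ := Metric.closedBall 0 (R + r)
    have hK : IsCompact K := isCompact_closedBall _ _
    refine ⟨fun y => C * (fiber ν y K).toReal,
      (ENNReal.summable_toReal (tsum_fiber_ne_top ν hK)).mul_left C, fun y t ht => ?_⟩
    have hle : ∀ s, φ (-s + t) ≤ K.indicator (fun _ => C) s := by
      intro s
      by_cases hs : s ∈ K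
      · rw [Set.indicator_of_mem hs]
        exact (Real.le_norm_self _).trans (hC _)
      · rw [Set.indicator_of_notMem hs]
        refine (image_eq_zero_of_notMem_tsupport fun hmem => hs ?_).le
        have h1 := hr hmem
        simp only [K, mem_closedBall_zero_iff, Real.norm_eq_abs] at h1 ⊢
        have := abs_sub t (-s + t)
        rw [show t - (-s + t) = s by ring] at this
        linarith
    calc ∫ s, φ (-s + t) ∂fiber ν y ≤ ∫ s, K.indicator (fun _ => C) s ∂fiber ν y := by
          refine integral_mono (hint y t) ?_ hle
          exact (integrable_indicator_iff hK.measurableSet).2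
            (integrableOn_const hK.measure_lt_top.ne)
      _ = C * (fiber ν y K).toReal := by
          rw [integral_indicator hK.measurableSet, setIntegral_const, smul_eq_mul, mul_comm]
          rfl
  · intro y t
    have hm : ∀ a : ℝ, Measurable fun s : ℝ => s + a := fun a => measurable_id.add_const a
    have hcomp : ∀ a s : ℝ, -(s + a) + t = -s + (t - a) := fun a s => by ring
    have hφm : ∀ m : Measure ℝ, AEStronglyMeasurable (fun s => φ (-s + t)) m := fun m =>
      Continuous.aestronglyMeasurable (by fun_prop)
    conv_lhs => rw [fiber_stationary hν y]
    rw [integral_finsetSum_measure]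
    · refine Finset.sum_congr rfl fun g _ => ?_
      rw [integral_smul_measure, integral_map (hm _).aemeasurable (hφm _), smul_eq_mul]
      simp only [hcomp]
    · intro g _
      refine Integrable.smul_measure ?_ (μ.apply_ne_top _)
      rw [integrable_map_measure (hφm _) (hm _).aemeasurable]
      simpa only [Function.comp_def, hcomp] using hint _ _

/-- **Invariance of the fibres**: the fibre over `g y` is the fibre over `y`, translated by
`χ g`. -/
lemma fiber_torusAct (hμ : μ.support.Finite) (hχ : ∀ g h, χ (g * h) = χ g + χ h)
    (hcent : Centered μ χ) (hν : IsStationaryRadon μ χ ν) (g : semigroup μ)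
    (y : UnitAddTorus (Fin d)) :
    fiber ν (torusAct g y) = (fiber ν y).map (fun s => s + χ g) := by
  have := hν.radon
  have hm : ∀ a : ℝ, Measurable fun s : ℝ => s + a := fun a => measurable_id.add_const a
  obtain ⟨g, hg⟩ := g
  induction hg using Subsemigroup.closure_induction generalizing y with
  | mem g hg =>
    set a := χ ⟨g, Subsemigroup.subset_closure hg⟩ with ha
    have hmap : IsFiniteMeasureOnCompacts ((fiber ν y).map (fun s => s + a)) :=
      Measure.IsFiniteMeasureOnCompacts.map _ (Homeomorph.addRight a)
    refine Measure.ext_of_integral_eq_on_compactlySupported_nnreal fun f => ?_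
    have hf : Continuous fun s : ℝ => ((f (-s) : ℝ≥0) : ℝ) := by fun_prop
    have hfc : HasCompactSupport fun s : ℝ => ((f (-s) : ℝ≥0) : ℝ) :=
      (f.hasCompactSupport.comp_homeomorph (Homeomorph.neg ℝ)).comp_left
        (g := fun z : ℝ≥0 => (z : ℝ)) rfl
    have h := integral_fiber_step hμ hcent hν hf hfc (fun s => NNReal.coe_nonneg _) ⟨g, hg⟩
      (torusAct g y) 0
    rw [show (torusPerm g).symm (torusAct g y) = y from (torusPerm g).symm_apply_apply y] at h
    rw [integral_map (hm a).aemeasurable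
      (Continuous.aestronglyMeasurable (by fun_prop))]
    simp only [add_zero, neg_neg, zero_sub, neg_add] at h
    exact h.symm
  | mul g h hg hh ihg ihh =>
    rw [torusAct_mul, ihg, ihh, Measure.map_map (hm _) (hm _)]
    congr 1
    funext s
    have : χ ⟨g * h, mul_mem hg hh⟩ = χ ⟨g, hg⟩ + χ ⟨h, hh⟩ := hχ ⟨g, hg⟩ ⟨h, hh⟩
    rw [Function.comp_apply, this]
    ring

end TorusWalk

namespace TorusWalk

/-! ### Proper real characters of semigroups -/

section Character

variable {G : Type*} [Group G] {Γ : Subsemigroup G} {χ : Γ → ℝ}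

lemma character_pow (hχ : ∀ g h, χ (g * h) = χ g + χ h) (g : Γ) (n : ℕ) :
    ∃ h : g.1 ^ (n + 1) ∈ Γ, χ ⟨g.1 ^ (n + 1), h⟩ = (n + 1) * χ g := by
  induction n with
  | zero => exact ⟨by simp, by simp⟩
  | succ n ih =>
    obtain ⟨h, ih⟩ := ih
    have e : g.1 ^ (n + 1 + 1) = g.1 ^ (n + 1) * g.1 := pow_succ _ _
    refine ⟨e ▸ mul_mem h g.2, ?_⟩
    have := hχ ⟨g.1 ^ (n + 1), h⟩ g
    rw [show (⟨g.1 ^ (n + 1 + 1), e ▸ mul_mem h g.2⟩ : Γ) = ⟨g.1 ^ (n + 1), h⟩ * g from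
      Subtype.ext e, this, ih]
    push_cast
    ring

lemma character_zpow (hχ : ∀ g h, χ (g * h) = χ g + χ h) {c : G} (hc : c ∈ Γ) (hc' : c⁻¹ ∈ Γ)
    (n : ℤ) : ∃ h : c ^ n ∈ Γ, χ ⟨c ^ n, h⟩ = n * χ ⟨c, hc⟩ := by
  have h1 : (1 : G) ∈ Γ := by simpa using mul_mem hc hc'
  have e1 : χ ⟨1, h1⟩ = 0 := by
    have := hχ ⟨1, h1⟩ ⟨1, h1⟩
    rw [show (⟨1, h1⟩ * ⟨1, h1⟩ : Γ) = ⟨1, h1⟩ from Subtype.ext (one_mul 1)] at this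
    linarith
  have ei : χ ⟨c⁻¹, hc'⟩ = -χ ⟨c, hc⟩ := by
    have := hχ ⟨c, hc⟩ ⟨c⁻¹, hc'⟩
    rw [show (⟨c, hc⟩ * ⟨c⁻¹, hc'⟩ : Γ) = ⟨1, h1⟩ from Subtype.ext (mul_inv_cancel c), e1] at this
    linarith
  induction n with
  | zero => exact ⟨by simpa using h1, by simpa using e1⟩
  | succ n ih =>
    obtain ⟨h, ih⟩ := ih
    have e : c ^ ((n : ℤ) + 1) = c ^ (n : ℤ) * c := zpow_add_one _ _
    refine ⟨e ▸ mul_mem h hc, ?_⟩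
    rw [show (⟨c ^ ((n : ℤ) + 1), e ▸ mul_mem h hc⟩ : Γ) = ⟨c ^ (n : ℤ), h⟩ * ⟨c, hc⟩ from
      Subtype.ext e, hχ, ih]
    push_cast
    ring
  | pred n ih =>
    obtain ⟨h, ih⟩ := ih
    have e : c ^ (-(n : ℤ) - 1) = c ^ (-(n : ℤ)) * c⁻¹ := zpow_sub_one _ _
    refine ⟨e ▸ mul_mem h hc', ?_⟩
    rw [show (⟨c ^ (-(n : ℤ) - 1), e ▸ mul_mem h hc'⟩ : Γ) = ⟨c ^ (-(n : ℤ)), h⟩ * ⟨c⁻¹, hc'⟩ from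
      Subtype.ext e, hχ, ih, ei]
    push_cast
    ring

/-- If only finitely many elements of a semigroup lie in each sublevel set of `|χ|`, and the
character `χ` takes both signs, then the semigroup contains an element `c` together with its
inverse, with `χ c ≠ 0`. For elements `a`, `b` on which `χ` has opposite signs, the elements
`a ^ n * b ^ m` with `n χ(a) + m χ(b)` bounded cannot all be distinct, and a coincidence between
them says that a power of `a` is inverse to a power of `b`. -/
lemma exists_unit_of_proper (hχ : ∀ g h, χ (g * h) = χ g + χ h)
    (hfin : ∀ R, {g : Γ | |χ g| ≤ R}.Finite) {a b : Γ} (ha : 0 < χ a) (hb : χ b < 0) :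
    ∃ c : G, ∃ hc : c ∈ Γ, c⁻¹ ∈ Γ ∧ χ ⟨c, hc⟩ ≠ 0 := by
  -- `m n` is chosen so that `(n + 1) χ(a) + (m n + 1) χ(b)` stays bounded
  set m : ℕ → ℕ := fun n => ⌊n * χ a / -χ b⌋₊ with hm
  have hpow := character_pow hχ
  let w : ℕ → Γ := fun n => ⟨a.1 ^ (n + 1), (hpow a n).1⟩ * ⟨b.1 ^ (m n + 1), (hpow b (m n)).1⟩
  have hbound : ∀ n, w n ∈ {g : Γ | |χ g| ≤ χ a - χ b} := by
    intro n
    have hb' : 0 < -χ b := by linarith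
    have h1 : (m n : ℝ) ≤ n * χ a / -χ b := Nat.floor_le (by positivity)
    have h2 : n * χ a / -χ b < m n + 1 := Nat.lt_floor_add_one _
    rw [le_div_iff₀ hb'] at h1
    rw [div_lt_iff₀ hb'] at h2
    simp only [w, Set.mem_ofPred_eq, hχ, (hpow a n).2, (hpow b (m n)).2]
    rw [abs_le]
    constructor <;> nlinarith
  obtain ⟨n, -, n', -, hne, heq⟩ := Set.infinite_univ.exists_lt_map_eq_of_mapsTo
    (fun n _ => hbound n) (hfin _)
  have h : a.1 ^ (n + 1) * b.1 ^ (m n + 1) = a.1 ^ (n' + 1) * b.1 ^ (m n' + 1) :=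
    congrArg Subtype.val heq
  obtain ⟨k, rfl⟩ : ∃ k, n' = n + (k + 1) := ⟨n' - n - 1, by omega⟩
  obtain ⟨l, hl⟩ : ∃ l, m (n + (k + 1)) = m n + l := Nat.exists_eq_add_of_le (by
    refine Nat.floor_le_floor (div_le_div_of_nonneg_right ?_ (by linarith))
    exact mul_le_mul_of_nonneg_right (by push_cast; linarith) ha.le)
  have hab : a.1 ^ (k + 1) * b.1 ^ l = 1 := by
    rw [hl, show n + (k + 1) + 1 = (n + 1) + (k + 1) by ring, pow_add _ (n + 1) (k + 1),
      show m n + l + 1 = l + (m n + 1) by ring, pow_add _ l (m n + 1)] at h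
    have h' : a.1 ^ (n + 1) * 1 * b.1 ^ (m n + 1)
        = a.1 ^ (n + 1) * (a.1 ^ (k + 1) * b.1 ^ l) * b.1 ^ (m n + 1) := by
      rw [mul_one, h]
      simp only [mul_assoc]
    exact (mul_left_cancel (mul_right_cancel h')).symm
  obtain ⟨hc, hχc⟩ := hpow a k
  have hχc0 : χ ⟨a.1 ^ (k + 1), hc⟩ ≠ 0 := by
    rw [hχc]
    positivity
  have hl0 : l ≠ 0 := by
    rintro rfl
    rw [pow_zero, mul_one] at hab
    obtain ⟨h2, e2⟩ := hpow ⟨_, hc⟩ 1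
    rw [show (⟨(a.1 ^ (k + 1)) ^ (1 + 1), h2⟩ : Γ) = ⟨a.1 ^ (k + 1), hc⟩ from
      Subtype.ext (by simp [hab])] at e2
    apply hχc0
    push_cast at e2
    linarith
  obtain ⟨l, rfl⟩ := Nat.exists_eq_succ_of_ne_zero hl0
  have hinv : (a.1 ^ (k + 1))⁻¹ = b.1 ^ (l + 1) := inv_eq_of_mul_eq_one_right hab
  exact ⟨a.1 ^ (k + 1), hc, hinv ▸ (hpow b l).1, hχc0⟩

end Character

/-! ### Invariant subspaces -/

variable {d : ℕ}

/-- The representation of `SL_d(ℤ)` on `ℝ^d`. -/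
noncomputable def linRep (d : ℕ) :
    SpecialLinearGroup (Fin d) ℤ →* Module.End ℝ (Fin d → ℝ) where
  toFun g := Matrix.mulVecLin ((g : Matrix (Fin d) (Fin d) ℤ).map (Int.cast : ℤ → ℝ))
  map_one' := by
    refine LinearMap.ext fun v => ?_
    simp [Matrix.map_one]
  map_mul' g h := by
    have : ((g * h : SpecialLinearGroup (Fin d) ℤ) : Matrix (Fin d) (Fin d) ℤ).map
        (Int.cast : ℤ → ℝ) = (g : Matrix (Fin d) (Fin d) ℤ).map (Int.cast : ℤ → ℝ)
          * (h : Matrix (Fin d) (Fin d) ℤ).map (Int.cast : ℤ → ℝ) := by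
      rw [Matrix.SpecialLinearGroup.coe_mul]
      exact Matrix.map_mul (f := Int.castRingHom ℝ)
    rw [this, Matrix.mulVecLin_mul]
    rfl

lemma linRep_injective : Function.Injective (linRep d) := by
  intro g h hgh
  have h1 : (g : Matrix (Fin d) (Fin d) ℤ).map (Int.cast : ℤ → ℝ)
      = (h : Matrix (Fin d) (Fin d) ℤ).map (Int.cast : ℤ → ℝ) :=
    Matrix.ext_iff_mulVec.2 fun v => LinearMap.congr_fun hgh v
  exact Subtype.ext (Matrix.map_injective Int.cast_injective h1)

lemma linRep_inv_apply (g : SpecialLinearGroup (Fin d) ℤ) (v : Fin d → ℝ) :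
    linRep d g⁻¹ (linRep d g v) = v := by
  rw [← Module.End.mul_apply, ← map_mul, inv_mul_cancel, map_one, Module.End.one_apply]

lemma linRep_apply_injective (g : SpecialLinearGroup (Fin d) ℤ) :
    Function.Injective (linRep d g) :=
  Function.LeftInverse.injective (linRep_inv_apply g)

lemma map_linRep_mul (g h : SpecialLinearGroup (Fin d) ℤ) (V : Submodule ℝ (Fin d → ℝ)) :
    V.map (linRep d (g * h)) = (V.map (linRep d h)).map (linRep d g) := by
  rw [map_mul, Module.End.mul_eq_comp, Submodule.map_comp]

lemma map_linRep_one (V : Submodule ℝ (Fin d → ℝ)) : V.map (linRep d 1) = V := by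
  rw [map_one, Module.End.one_eq_id, Submodule.map_id]

lemma map_linRep_eq_of_le {g : SpecialLinearGroup (Fin d) ℤ} {V : Submodule ℝ (Fin d → ℝ)}
    (h : V.map (linRep d g) ≤ V) : V.map (linRep d g) = V :=
  Submodule.eq_of_le_of_finrank_eq h
    (LinearEquiv.finrank_eq (Submodule.equivMapOfInjective _ (linRep_apply_injective g) V)).symm

variable {Γ : Subsemigroup (SpecialLinearGroup (Fin d) ℤ)}

/-- Under strong irreducibility, a proper nonzero subspace has infinitely many translates. -/
lemma StronglyIrreducible.infinite_translates (hirr : StronglyIrreducible Γ)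
    (hΓ : (Γ : Set (SpecialLinearGroup (Fin d) ℤ)).Nonempty) {V : Submodule ℝ (Fin d → ℝ)}
    (hbot : V ≠ ⊥) (htop : V ≠ ⊤) : ¬ ((fun g => V.map (linRep d g)) '' Γ).Finite := by
  intro hfin
  refine hirr ⟨_, hfin, hΓ.image _, ?_, ?_⟩
  · rintro _ ⟨g, -, rfl⟩
    dsimp only
    refine ⟨fun h => hbot ?_, fun h => htop ?_⟩
    · exact Submodule.map_injective_of_injective (linRep_apply_injective g)
        (h.trans (Submodule.map_bot _).symm)
    · have h2 : (V.map (linRep d g)).map (linRep d g⁻¹) = V := by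
        rw [← map_linRep_mul, inv_mul_cancel, map_linRep_one]
      rw [← h2, h, eq_top_iff]
      rintro v -
      refine ⟨linRep d g v, trivial, linRep_inv_apply g v⟩
  · intro g hg v hv
    simp only [Set.mem_iUnion, Set.mem_image] at hv ⊢
    obtain ⟨_, ⟨h, hh, rfl⟩, hv⟩ := hv
    refine ⟨_, ⟨g * h, mul_mem hg hh, rfl⟩, ?_⟩
    rw [map_linRep_mul]
    exact Submodule.mem_map_of_mem hv

lemma StronglyIrreducible.span_orbit (hirr : StronglyIrreducible Γ)
    (hΓ : (Γ : Set (SpecialLinearGroup (Fin d) ℤ)).Nonempty) {v : Fin d → ℝ} (hv : v ≠ 0) :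
    Submodule.span ℝ ((fun g => linRep d g v) '' Γ) = ⊤ := by
  set V := Submodule.span ℝ ((fun g => linRep d g v) '' (Γ : Set _)) with hV
  by_contra htop
  have hbot : V ≠ ⊥ := by
    obtain ⟨g, hg⟩ := hΓ
    intro h
    have : linRep d g v ∈ V := Submodule.subset_span ⟨g, hg, rfl⟩
    rw [h, Submodule.mem_bot] at this
    exact hv (linRep_apply_injective g (this.trans (map_zero _).symm))
  refine hirr.infinite_translates hΓ hbot htop ((Set.finite_singleton V).subset ?_)
  rintro _ ⟨g, hg, rfl⟩
  refine map_linRep_eq_of_le (g := g) ?_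
  rw [hV, Submodule.map_span, Submodule.span_le]
  rintro _ ⟨_, ⟨h, hh, rfl⟩, rfl⟩
  refine Submodule.subset_span ⟨g * h, mul_mem hg hh, ?_⟩
  simp only [map_mul, Module.End.mul_apply]

/-- A set of linear maps is finite if it moves each vector of a spanning set to finitely many
places. -/
lemma finite_of_finite_orbits {A : Set (SpecialLinearGroup (Fin d) ℤ)} {S : Set (Fin d → ℝ)}
    (hS : Submodule.span ℝ S = ⊤) (hfin : ∀ v ∈ S, ((fun g => linRep d g v) '' A).Finite) :
    A.Finite := by
  obtain ⟨T, hTS, hT⟩ := Submodule.fg_span_iff_fg_span_finset_subset S |>.1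
    (hS ▸ Module.Finite.fg_top)
  have hpi : (Set.univ.pi fun v : T => (fun g => linRep d g (v : Fin d → ℝ)) '' A).Finite :=
    Set.Finite.pi fun v => hfin v (hTS v.2)
  refine Set.Finite.of_injOn (f := fun g (v : T) => linRep d g (v : Fin d → ℝ)) (s := A)
    (t := Set.univ.pi fun v : T => (fun g => linRep d g (v : Fin d → ℝ)) '' A)
    (fun g hg v _ => ⟨g, hg, rfl⟩) (fun g _ h _ hgh => linRep_injective ?_) hpi
  refine LinearMap.ext_on (hT.symm.trans hS) fun v hv => congrFun hgh ⟨v, hv⟩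

/-- A real endomorphism of a nonzero finite-dimensional space leaves invariant a subspace
spanned by a nonzero vector and its image, since irreducible real polynomials have degree at
most two. -/
lemma exists_invariant_span_pair {E : Type*} [AddCommGroup E] [Module ℝ E]
    [FiniteDimensional ℝ E] [Nontrivial E] (f : Module.End ℝ E) :
    ∃ v : E, v ≠ 0 ∧ (Submodule.span ℝ {v, f v}).map f ≤ Submodule.span ℝ {v, f v} := by
  have hint : IsIntegral ℝ f := Algebra.IsIntegral.isIntegral f
  obtain ⟨q, hq, r, hr⟩ := WfDvdMonoid.exists_irreducible_factor
    (minpoly.not_isUnit ℝ f) (minpoly.ne_zero hint)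
  obtain ⟨v, hv0, hv⟩ : ∃ v : E, v ≠ 0 ∧ Polynomial.aeval f q v = 0 := by
    by_contra! hcon
    have hinj : Function.Injective (Polynomial.aeval f q) :=
      (injective_iff_map_eq_zero _).2 fun v hv => by_contra fun h => hcon v h hv
    have hr0 : Polynomial.aeval f r = 0 := by
      ext v
      apply hinj
      rw [← Module.End.mul_apply, ← map_mul, ← hr, minpoly.aeval]
      simp
    have hrne : r ≠ 0 := fun h => minpoly.ne_zero hint (by rw [hr, h, mul_zero])
    have hdeg := Polynomial.natDegree_le_of_dvd (minpoly.dvd ℝ f hr0) hrne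
    rw [hr, Polynomial.natDegree_mul hq.ne_zero hrne] at hdeg
    have := hq.natDegree_pos
    omega
  refine ⟨v, hv0, ?_⟩
  set V := Submodule.span ℝ {v, f v} with hV
  have hvV : v ∈ V := Submodule.subset_span (by simp)
  have hfV : f v ∈ V := Submodule.subset_span (by simp)
  rw [Submodule.map_span_le]
  rintro w (rfl | rfl)
  · exact hfV
  · have hquad := Polynomial.eq_quadratic_of_degree_le_two hq.degree_le_two
    set a := q.coeff 2
    set b := q.coeff 1
    set c := q.coeff 0
    have hrel : a • f (f v) + b • f v + c • v = 0 := by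
      rw [hquad] at hv
      simpa [pow_two, Algebra.algebraMap_eq_smul_one] using hv
    by_cases ha : a = 0
    · have hb : b ≠ 0 := by
        intro hb
        have hc : c = 0 := by
          rw [ha, hb, zero_smul, zero_smul, zero_add, zero_add] at hrel
          exact (smul_eq_zero.1 hrel).resolve_right hv0
        exact hq.ne_zero (by rw [hquad, ha, hb, hc]; simp)
      have hfv : f v = (-(c / b)) • v := by
        have : b • f v = -(c • v) := by
          rw [ha, zero_smul, zero_add] at hrel
          exact eq_neg_of_add_eq_zero_left hrel
        rw [← inv_smul_smul₀ hb (f v), this, smul_neg, smul_smul, neg_smul]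
        congr 2
        field_simp
      rw [hfv, map_smul]
      exact V.smul_mem _ hfV
    · have hff : f (f v) = a⁻¹ • (-(b • f v + c • v)) := by
        have : a • f (f v) = -(b • f v + c • v) := by
          rw [add_assoc] at hrel
          exact eq_neg_of_add_eq_zero_left hrel
        rw [← this, inv_smul_smul₀ ha]
      rw [hff]
      exact V.smul_mem _ (V.neg_mem (V.add_mem (V.smul_mem _ hfV) (V.smul_mem _ hvV)))

lemma pow_twelve_eq_one_of_trace {R : Type*} [Ring R] {M : R} {t : ℤ} (h : M ^ 2 = t * M - 1)
    (ht : |t| ≤ 1) : M ^ 12 = 1 := by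
  obtain ⟨h1, h2⟩ := abs_le.1 ht
  interval_cases t
  · have h3 : M ^ 3 = 1 := by
      rw [pow_succ, h, Int.cast_neg, Int.cast_one, neg_one_mul, sub_mul, neg_mul, ← pow_two, h]
      simp
    rw [show 12 = 3 * 4 from rfl, pow_mul, h3, one_pow]
  · have h2 : M ^ 2 = -1 := by simpa using h
    rw [show 12 = 2 * 6 from rfl, pow_mul, h2, Even.neg_one_pow (by decide)]
  · have h3 : M ^ 3 = -1 := by
      rw [pow_succ, h, Int.cast_one, one_mul, sub_mul, one_mul, ← pow_two, h]
      simp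
    rw [show 12 = 3 * 4 from rfl, pow_mul, h3, Even.neg_one_pow (by decide)]

/-- An element of `SL_d(ℤ)`, `d ≥ 2`, of infinite order has a proper nonzero invariant subspace in
`ℝ^d`: for `d = 2` an elliptic element has trace `-1`, `0` or `1` and hence finite order. -/
lemma exists_invariant_or_pow_eq_one (hd : 2 ≤ d) (g : SpecialLinearGroup (Fin d) ℤ) :
    (∃ V : Submodule ℝ (Fin d → ℝ), V ≠ ⊥ ∧ V ≠ ⊤ ∧ V.map (linRep d g) ≤ V) ∨ g ^ 12 = 1 := by
  have : Nonempty (Fin d) := ⟨⟨0, by omega⟩⟩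
  rcases hd.lt_or_eq with hd | rfl
  · left
    obtain ⟨v, hv, hV⟩ := exists_invariant_span_pair (linRep d g)
    refine ⟨_, ?_, ?_, hV⟩
    · rw [Submodule.ne_bot_iff]
      exact ⟨v, Submodule.subset_span (by simp), hv⟩
    · intro htop
      have h1 := finrank_span_finset_le_card (R := ℝ) ({v, linRep d g v} : Finset (Fin d → ℝ))
      rw [Finset.coe_pair, Set.finrank, htop, finrank_top, Module.finrank_fin_fun] at h1
      have := Finset.card_le_two (a := v) (b := linRep d g v)
      omega
  · set M : Matrix (Fin 2) (Fin 2) ℤ := g.1 with hM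
    have hdet : M 0 0 * M 1 1 - M 0 1 * M 1 0 = 1 := by
      rw [← Matrix.det_fin_two, hM, g.det_coe]
    set t : ℤ := M 0 0 + M 1 1 with ht
    rcases le_or_gt |t| 1 with h | h
    · right
      have hsq : M ^ 2 = (t : Matrix (Fin 2) (Fin 2) ℤ) * M - 1 := by
        rw [pow_two]
        ext i j
        fin_cases i <;> fin_cases j <;>
          simp [Matrix.mul_apply, Fin.sum_univ_two, Matrix.sub_apply, ht,
            Matrix.intCast_apply] <;> linarith
      apply Subtype.ext
      have := pow_twelve_eq_one_of_trace hsq h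
      rw [Matrix.SpecialLinearGroup.coe_pow]
      exact this
    · left
      have hdisc : (0 : ℝ) ≤ (t : ℝ) ^ 2 - 4 := by
        have h4 : (4 : ℤ) ≤ t ^ 2 := by
          rw [← sq_abs]; nlinarith
        have : (4 : ℝ) ≤ (t : ℝ) ^ 2 := by exact_mod_cast h4
        linarith
      set x : ℝ := (t + Real.sqrt ((t : ℝ) ^ 2 - 4)) / 2 with hx
      have hroot : x ^ 2 - t * x + 1 = 0 := by
        have := Real.sq_sqrt hdisc
        rw [hx]
        nlinarith
      set A : Matrix (Fin 2) (Fin 2) ℝ := M.map (Int.cast : ℤ → ℝ) with hA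
      have hdetA : (A - x • (1 : Matrix (Fin 2) (Fin 2) ℝ)).det = 0 := by
        have hdet' : (M 0 0 : ℝ) * M 1 1 - M 0 1 * M 1 0 = 1 := by exact_mod_cast hdet
        have ht' : (t : ℝ) = M 0 0 + M 1 1 := by rw [ht]; push_cast; ring
        rw [ht'] at hroot
        rw [Matrix.det_fin_two]
        simp [hA]
        nlinarith
      obtain ⟨v, hv, hAv⟩ := Matrix.exists_mulVec_eq_zero_iff.2 hdetA
      rw [Matrix.sub_mulVec, Matrix.smul_mulVec, Matrix.one_mulVec, sub_eq_zero] at hAv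
      refine ⟨Submodule.span ℝ {v}, by simpa using hv, ?_, ?_⟩
      · intro htop
        have h1 := finrank_span_singleton (K := ℝ) hv
        rw [htop, finrank_top, Module.finrank_fin_fun] at h1
        omega
      · rw [Submodule.map_span_le]
        rintro w rfl
        have : linRep 2 g w = x • w := hAv
        rw [this]
        exact Submodule.smul_mem _ _ (Submodule.mem_span_singleton_self w)

end TorusWalk

namespace TorusWalk

variable {d : ℕ} {μ : PMF (SpecialLinearGroup (Fin d) ℤ)} {χ : semigroup μ → ℝ}
  {ν : Measure (UnitAddTorus (Fin d) × ℝ)}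

/-! ### Centered characters -/

lemma semigroup_nonempty (μ : PMF (SpecialLinearGroup (Fin d) ℤ)) :
    (semigroup μ : Set (SpecialLinearGroup (Fin d) ℤ)).Nonempty :=
  μ.support_nonempty.mono Subsemigroup.subset_closure

lemma mul_character_eq_zero_of_nonneg (hcent : Centered μ χ) {σ : ℝ}
    (h : ∀ g : μ.support, 0 ≤ σ * χ (gen μ g)) (g : μ.support) : σ * χ (gen μ g) = 0 := by
  have h0 : HasSum (fun g : μ.support => (μ g).toReal * (σ * χ (gen μ g))) 0 := by
    simpa [mul_left_comm] using hcent.mul_left σ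
  have := congrFun ((hasSum_zero_iff_of_nonneg fun g =>
    mul_nonneg ENNReal.toReal_nonneg (h g)).1 h0) g
  refine (mul_eq_zero.1 this).resolve_left (ENNReal.toReal_pos ?_ (μ.apply_ne_top _)).ne'
  exact (μ.mem_support_iff _).1 g.2

/-- A centered character vanishes or takes both signs. -/
lemma character_eq_zero_or_signs (hχ : ∀ g h, χ (g * h) = χ g + χ h) (hcent : Centered μ χ) :
    (∀ g, χ g = 0) ∨ (∃ a, 0 < χ a) ∧ ∃ b, χ b < 0 := by
  by_cases h0 : ∀ g : μ.support, χ (gen μ g) = 0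
  · left
    rintro ⟨g, hg⟩
    induction hg using Subsemigroup.closure_induction with
    | mem g hg => exact h0 ⟨g, hg⟩
    | mul g h hg hh ihg ihh =>
      exact (hχ ⟨g, hg⟩ ⟨h, hh⟩).trans (by rw [ihg, ihh, add_zero])
  · right
    constructor <;> by_contra! hcon <;> refine h0 fun g => ?_
    · simpa using mul_character_eq_zero_of_nonneg (σ := -1) hcent
        (fun g => by linarith [hcon (gen μ g)]) g
    · simpa using mul_character_eq_zero_of_nonneg (σ := 1) hcent
        (fun g => by linarith [hcon (gen μ g)]) g

/-- The closure of a subset of the line that is stable under addition and meets both half-lines is a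
group. By Dirichlet's theorem some `k * α + j * β` with `k > 0`, `j ≥ 0` is as small as desired. -/
lemma neg_mem_closure {S : Set ℝ} (hS : ∀ a ∈ S, ∀ b ∈ S, a + b ∈ S) {α β : ℝ} (hα : α ∈ S)
    (hβ : β ∈ S) (hαβ : α * β < 0) : -α ∈ closure S := by
  have hmul : ∀ a ∈ S, ∀ n : ℕ, ((n : ℝ) + 1) * a ∈ S := by
    intro a ha n
    induction n with
    | zero => simpa using ha
    | succ n ih =>
      have := hS _ ih _ ha
      push_cast
      convert! this using 1
      ring
  have hβ0 : β ≠ 0 := by rintro rfl; simp at hαβ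
  have hξ : 0 < -α / β := by
    rw [show -α / β = -(α * β) / β ^ 2 by field_simp]
    have := pow_pos (abs_pos.2 hβ0) 2
    rw [sq_abs] at this
    exact div_pos (by linarith) this
  refine Metric.mem_closure_iff.2 fun ε hε => ?_
  obtain ⟨n, hn⟩ := exists_nat_gt (2 * |β| / ε)
  have hn0 : 0 < n := by
    have : (0 : ℝ) < n := lt_of_le_of_lt (by positivity) hn
    exact_mod_cast this
  obtain ⟨k, hk0, -, hk⟩ := Real.exists_nat_abs_mul_sub_round_le (-α / β) hn0
  have hj0 : 0 ≤ round ((k : ℝ) * (-α / β)) := by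
    rw [round_eq]
    exact Int.floor_nonneg.2 (by positivity)
  obtain ⟨j, hj⟩ := Int.eq_ofNat_of_zero_le hj0
  rw [hj, Int.cast_natCast] at hk
  -- doubling `k` and `j` leaves at least one `α` after subtracting `α`
  refine ⟨((2 * k - 2 : ℕ) + 1) * α + (2 * j : ℕ) * β, ?_, ?_⟩
  · rcases Nat.eq_zero_or_pos (2 * j) with h | h
    · rw [h]
      simpa using hmul α hα (2 * k - 2)
    · refine hS _ (hmul α hα _) _ ?_
      obtain ⟨i, hi⟩ := Nat.exists_eq_succ_of_ne_zero h.ne'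
      rw [hi]
      push_cast
      exact hmul β hβ i
  · have e : -α - (((2 * k - 2 : ℕ) + 1) * α + (2 * j : ℕ) * β)
        = 2 * β * (k * (-α / β) - j) := by
      rw [Nat.cast_sub (by omega)]
      push_cast
      field_simp
      ring
    rw [Real.dist_eq, e, abs_mul, abs_mul, abs_two]
    calc 2 * |β| * |k * (-α / β) - j| ≤ 2 * |β| * (1 / (n + 1)) := by gcongr
      _ < ε := by
        rw [mul_one_div, div_lt_iff₀ (by positivity)]
        rw [div_lt_iff₀ hε] at hn
        nlinarith

/-- The values of a centered character form a dense set or a discrete subgroup of `ℝ`. -/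
lemma range_character_dense_or_zmultiples (hχ : ∀ g h, χ (g * h) = χ g + χ h)
    (hcent : Centered μ χ) :
    Dense (Set.range χ) ∨ ∃ a : ℝ, Set.range χ = AddSubgroup.zmultiples a := by
  set S := Set.range χ
  have hS : ∀ a ∈ S, ∀ b ∈ S, a + b ∈ S := by
    rintro _ ⟨g, rfl⟩ _ ⟨h, rfl⟩
    exact ⟨g * h, hχ g h⟩
  rcases character_eq_zero_or_signs hχ hcent with h0 | ⟨⟨a, ha⟩, b, hb⟩
  · right
    obtain ⟨g, hg⟩ := semigroup_nonempty μ
    refine ⟨0, ?_⟩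
    ext s
    simp only [AddSubgroup.zmultiples_zero_eq_bot, SetLike.mem_coe, AddSubgroup.mem_bot]
    exact ⟨fun ⟨g, h⟩ => h ▸ h0 g, fun h => ⟨⟨g, hg⟩, (h0 _).trans h.symm⟩⟩
  have hadd : ∀ x ∈ closure S, ∀ y ∈ closure S, x + y ∈ closure S := fun x hx y hy =>
    map_mem_closure₂ continuous_add hx hy hS
  have hneg : ∀ x ∈ S, -x ∈ closure S := by
    intro x hx
    rcases lt_trichotomy x 0 with h | h | h
    · exact neg_mem_closure hS hx ⟨a, rfl⟩ (mul_neg_of_neg_of_pos h ha)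
    · rw [h, neg_zero, ← h]
      exact subset_closure hx
    · exact neg_mem_closure hS hx ⟨b, rfl⟩ (mul_neg_of_pos_of_neg h hb)
  let H : AddSubgroup ℝ :=
    { carrier := closure S
      add_mem' := fun hx hy => hadd _ hx _ hy
      zero_mem' := by
        have := hadd _ (subset_closure ⟨a, rfl⟩) _ (hneg _ ⟨a, rfl⟩)
        rwa [add_neg_cancel] at this
      neg_mem' := fun {x} hx => by
        have := map_mem_closure continuous_neg hx hneg
        rwa [closure_closure] at this }
  rcases H.dense_or_cyclic with h | ⟨c, hc⟩
  · left
    exact dense_closure.1 h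
  · right
    refine ⟨c, ?_⟩
    have hcl : closure S = AddSubgroup.zmultiples c := by
      rw [AddSubgroup.zmultiples_eq_closure, ← hc]
      rfl
    have hclosed : IsClosed S := isClosed_of_subset_discrete_closed
      (t := (AddSubgroup.zmultiples c : Set ℝ)) (hcl ▸ subset_closure)
      (SetLike.isDiscrete_iff_discreteTopology.2 inferInstance)
      (hcl ▸ isClosed_closure)
    rw [← hcl, hclosed.closure_eq]

lemma not_isDiscrete_of_dense {S : Set ℝ} (hS : Dense S) : ¬ IsDiscrete S := by
  intro h
  obtain ⟨y, hy⟩ := hS.nonempty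
  obtain ⟨u, hu, huS⟩ := isDiscrete_iff_forall_mem_exists_isOpen.1 h y hy
  have hyu : y ∈ u := (huS.symm ▸ Set.mem_singleton y : y ∈ u ∩ S).1
  obtain ⟨z, hzu, hzS, hzy⟩ := (hS.sdiff_singleton y).inter_open_nonempty u hu ⟨y, hyu⟩
  exact hzy (huS ▸ ⟨hzu, hzS⟩ : z ∈ ({y} : Set ℝ))

/-! ### Atoms sit over rational points -/

/-- A centered character of a strongly irreducible semigroup of integer matrices has an infinite
sublevel set. Otherwise, up to finitely many factors, the semigroup would consist of the powers of
a single element `c`, and a subspace invariant under `c` would have finitely many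
translates. -/
lemma not_proper_character (hd : 2 ≤ d) (hirr : StronglyIrreducible (semigroup μ))
    (hχ : ∀ g h, χ (g * h) = χ g + χ h) (hcent : Centered μ χ) : ¬ ∀ R, {g : semigroup μ | |χ g| ≤ R}.Finite := by
  intro hfin
  rcases character_eq_zero_or_signs hχ hcent with h0 | ⟨⟨a, ha⟩, b, hb⟩
  · -- the semigroup is finite, hence moves a line to finitely many places
    have hΓ : (semigroup μ : Set (SpecialLinearGroup (Fin d) ℤ)).Finite := by
      have := (hfin 0).image (Subtype.val)
      refine this.subset fun g hg => ⟨⟨g, hg⟩, ?_, rfl⟩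
      simp [h0]
    have : Nontrivial (Fin d → ℝ) := by
      have : Nonempty (Fin d) := ⟨⟨0, by omega⟩⟩
      infer_instance
    obtain ⟨v, hv⟩ := exists_ne (0 : Fin d → ℝ)
    refine hirr.infinite_translates (semigroup_nonempty μ) (V := Submodule.span ℝ {v})
      (by simpa using hv) (fun htop => ?_) (hΓ.image _)
    have h1 := finrank_span_singleton (K := ℝ) hv
    rw [htop, finrank_top, Module.finrank_fin_fun] at h1
    omega
  · obtain ⟨c, hc, hc', hχc⟩ := exists_unit_of_proper hχ hfin ha hb
    have hzpow := character_zpow hχ hc hc'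
    rcases exists_invariant_or_pow_eq_one hd c with ⟨V, hbot, htop, hV⟩ | h12
    · have hV' : ∀ n : ℤ, V.map (linRep d (c ^ n)) = V := by
        have h1 := map_linRep_eq_of_le hV
        have h2 : V.map (linRep d c⁻¹) = V := by
          conv_lhs => rw [← h1, ← map_linRep_mul, inv_mul_cancel, map_linRep_one]
        intro n
        induction n with
        | zero => rw [zpow_zero, map_linRep_one]
        | succ n ih => rw [_root_.zpow_add_one, map_linRep_mul, h1, ih]
        | pred n ih => rw [_root_.zpow_sub_one, map_linRep_mul, h2, ih]
      refine hirr.infinite_translates (semigroup_nonempty μ) hbot htop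
        (((hfin |χ ⟨c, hc⟩|).image fun g => V.map (linRep d g.1)).subset ?_)
      rintro _ ⟨g, hg, rfl⟩
      -- dividing `g` by this power of `c` brings `|χ|` below `|χ c|`
      set n : ℤ := ⌊χ ⟨g, hg⟩ / χ ⟨c, hc⟩⌋ with hn
      obtain ⟨hm, em⟩ := hzpow (-n)
      refine ⟨⟨g, hg⟩ * ⟨c ^ (-n), hm⟩, ?_, ?_⟩
      · have e : χ ⟨g, hg⟩ + ((-n : ℤ) : ℝ) * χ ⟨c, hc⟩
            = (χ ⟨g, hg⟩ / χ ⟨c, hc⟩ - n) * χ ⟨c, hc⟩ := by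
          field_simp
          push_cast
          ring
        rw [Set.mem_ofPred_eq, hχ, em, e, abs_mul]
        refine mul_le_of_le_one_left (abs_nonneg _) ?_
        have h1 := Int.floor_le (χ ⟨g, hg⟩ / χ ⟨c, hc⟩)
        have h2 := Int.lt_floor_add_one (χ ⟨g, hg⟩ / χ ⟨c, hc⟩)
        rw [abs_le]
        constructor <;> linarith
      · change V.map (linRep d (g * c ^ (-n))) = _
        rw [map_linRep_mul, hV']
    · obtain ⟨h1, e1⟩ := hzpow 12
      obtain ⟨h2, e2⟩ := hzpow 0
      have : (⟨c ^ (12 : ℤ), h1⟩ : semigroup μ) = ⟨c ^ (0 : ℤ), h2⟩ :=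
        Subtype.ext ((by exact_mod_cast h12 : c ^ (12 : ℤ) = 1).trans (zpow_zero c).symm)
      rw [this, e2] at e1
      apply hχc
      push_cast at e1
      linarith

/-- A point of the circle that is not rational is detected by a homomorphism from the circle to the
line (discontinuous, built from a linear form over `ℚ`). -/
lemma exists_addMonoidHom_ne_zero {z : UnitAddCircle}
    (hz : ∀ q : ℚ, z ≠ ((q : ℝ) : UnitAddCircle)) :
    ∃ L : UnitAddCircle →+ ℝ, L z ≠ 0 := by
  obtain ⟨r, rfl⟩ := QuotientAddGroup.mk_surjective z
  set W : Submodule ℚ ℝ := Submodule.span ℚ {1} with hW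
  have hr : W.mkQ r ≠ 0 := by
    rw [Submodule.mkQ_apply, Ne, Submodule.Quotient.mk_eq_zero, hW, Submodule.mem_span_singleton]
    rintro ⟨q, hq⟩
    refine hz q ?_
    rw [← hq, Rat.smul_one_eq_cast]
  obtain ⟨φ, hφ⟩ : ∃ φ : Module.Dual ℚ (ℝ ⧸ W), φ (W.mkQ r) ≠ 0 := by
    by_contra! h
    exact hr ((Module.forall_dual_apply_eq_zero_iff ℚ _).1 h)
  let ℓ : ℝ →+ ℝ := (Rat.castHom ℝ : ℚ →+ ℝ).comp
    ((φ.comp W.mkQ : ℝ →ₗ[ℚ] ℚ).toAddMonoidHom)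
  refine ⟨QuotientAddGroup.lift _ ℓ ?_, ?_⟩
  · rw [AddSubgroup.zmultiples_le]
    have h1 : W.mkQ 1 = 0 := by
      rw [Submodule.mkQ_apply, Submodule.Quotient.mk_eq_zero]
      exact Submodule.mem_span_singleton_self 1
    change ((φ (W.mkQ 1) : ℚ) : ℝ) = 0
    rw [h1, map_zero, Rat.cast_zero]
  · change ((φ (W.mkQ r) : ℚ) : ℝ) ≠ 0
    exact_mod_cast hφ

lemma linRep_map_torus (L : UnitAddCircle →+ ℝ) (g : SpecialLinearGroup (Fin d) ℤ)
    (y : UnitAddTorus (Fin d)) :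
    (fun i => L (torusAct g y i)) = linRep d g (fun i => L (y i)) := by
  funext i
  simp only [torusAct, map_sum, map_zsmul]
  simp [linRep, Matrix.mulVec, dotProduct]

/-- Over a point with a nonzero fibre, the part of the orbit reached with bounded displacement is
finite: the translates of the fibre carry a definite mass on a fixed compact interval. -/
lemma finite_bounded_orbit (hμ : μ.support.Finite) (hχ : ∀ g h, χ (g * h) = χ g + χ h)
    (hcent : Centered μ χ) (hν : IsStationaryRadon μ χ ν) {x : UnitAddTorus (Fin d)}
    (hx : 0 < ν ({x} ×ˢ Set.univ)) (R : ℝ) :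
    ((fun g : semigroup μ => torusAct g x) '' {g | |χ g| ≤ R}).Finite := by
  have := hν.radon
  obtain ⟨r, hr⟩ : ∃ r : ℕ, fiber ν x (Metric.closedBall 0 r) ≠ 0 := by
    by_contra! hcon
    have : fiber ν x (⋃ r : ℕ, Metric.closedBall 0 (r : ℝ)) = 0 := measure_iUnion_null hcon
    rw [Metric.iUnion_closedBall_nat, fiber_apply ν x MeasurableSet.univ] at this
    exact hx.ne' this
  refine (ENNReal.finite_const_le_of_tsum_ne_top
    (tsum_fiber_ne_top ν (isCompact_closedBall 0 (r + R))) hr).subset ?_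
  rintro _ ⟨g, hg, rfl⟩
  rw [Set.mem_ofPred_eq, fiber_torusAct hμ hχ hcent hν, Measure.map_apply
    (measurable_id'.add_const _) Metric.isClosed_closedBall.measurableSet]
  refine measure_mono fun s hs => ?_
  simp only [Set.mem_preimage, mem_closedBall_zero_iff, Real.norm_eq_abs] at hs ⊢
  exact (abs_add_le _ _).trans (add_le_add hs hg)

/-- An atom of the projection of `ν` to the torus is rational. Otherwise a homomorphism from the
circle to the line turns the orbit of `x` into the orbit of a nonzero vector of `ℝ^d`; as that orbit
spans, the elements of bounded displacement would be finite in number. -/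
lemma isRationalPoint_of_atom (hd : 2 ≤ d) (hμ : μ.support.Finite)
    (hirr : StronglyIrreducible (semigroup μ)) (hχ : ∀ g h, χ (g * h) = χ g + χ h)
    (hcent : Centered μ χ) (hν : IsStationaryRadon μ χ ν) {x : UnitAddTorus (Fin d)}
    (hx : 0 < ν ({x} ×ˢ Set.univ)) : IsRationalPoint x := by
  by_contra hrat
  obtain ⟨i, hi⟩ : ∃ i, ∀ q : ℚ, x i ≠ ((q : ℝ) : UnitAddCircle) := by
    by_contra! h
    choose q hq using h
    exact hrat ⟨q, hq⟩
  obtain ⟨L, hL⟩ := exists_addMonoidHom_ne_zero hi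
  set v : Fin d → ℝ := fun i => L (x i) with hv
  have hv0 : v ≠ 0 := fun h => hL (congrFun h i)
  refine not_proper_character hd hirr hχ hcent fun R => ?_
  refine Set.Finite.of_finite_image (f := Subtype.val) ?_ Subtype.val_injective.injOn
  refine finite_of_finite_orbits (hirr.span_orbit (semigroup_nonempty μ) hv0) ?_
  rintro _ ⟨h, hh, rfl⟩
  refine ((finite_bounded_orbit hμ hχ hcent hν hx (R + |χ ⟨h, hh⟩|)).image
    fun y i => L (y i)).subset ?_
  rintro _ ⟨_, ⟨g, hg, rfl⟩, rfl⟩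
  refine ⟨_, ⟨g * ⟨h, hh⟩, ?_, rfl⟩, ?_⟩
  · rw [Set.mem_ofPred_eq, hχ]
    exact (abs_add_le _ _).trans (by have : |χ g| ≤ R := hg; linarith)
  · change (fun i => L (torusAct (g.1 * h) x i)) = _
    rw [linRep_map_torus, map_mul]
    rfl

/-! ### Finite orbits -/

lemma exists_torsion_of_isRationalPoint {x : UnitAddTorus (Fin d)} (hx : IsRationalPoint x) :
    ∃ N : ℕ, 0 < N ∧ N • x = 0 := by
  obtain ⟨q, hq⟩ := hx
  refine ⟨∏ i, (q i).den, Finset.prod_pos fun i _ => (q i).pos, ?_⟩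
  funext i
  obtain ⟨k, hk⟩ := Finset.dvd_prod_of_mem (fun i => (q i).den) (Finset.mem_univ i)
  have hden : (q i).den • x i = 0 := by
    rw [hq, ← AddCircle.coe_nsmul, AddCircle.coe_eq_zero_iff]
    refine ⟨(q i).num, ?_⟩
    have : ((q i).den : ℝ) * (q i : ℝ) = (q i).num := by exact_mod_cast Rat.den_mul_eq_num (q i)
    rw [nsmul_eq_mul, this]
    simp
  rw [Pi.smul_apply, hk, mul_comm, mul_smul, hden, smul_zero]
  rfl

lemma finite_torsion_torus {N : ℕ} (hN : 0 < N) :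
    {y : UnitAddTorus (Fin d) | N • y = 0}.Finite := by
  have := Set.Finite.pi fun _ : Fin d => AddCircle.finite_torsion (p := (1 : ℝ)) hN
  exact this.subset fun y hy i _ => congrFun hy i

/-- A common power of all elements of `SL_d(ℤ)` acts trivially on the torsion points of a given
order. -/
lemma exists_pow_fixing_torsion {N : ℕ} (hN : 0 < N) :
    ∃ n : ℕ, ∀ (g : SpecialLinearGroup (Fin d) ℤ) (y : UnitAddTorus (Fin d)), N • y = 0 →
      torusAct (g ^ (n + 1)) y = y := by
  set T : Set (UnitAddTorus (Fin d)) := {y | N • y = 0}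
  have := (finite_torsion_torus (d := d) hN).to_subtype
  have hT : ∀ (g : SpecialLinearGroup (Fin d) ℤ) (y : UnitAddTorus (Fin d)),
      torusPerm g y ∈ T ↔ y ∈ T := by
    intro g y
    change N • torusAct g y = 0 ↔ N • y = 0
    have h0 : torusAct g 0 = 0 := by funext i; simp [torusAct]
    rw [← torusAct_smul]
    exact ⟨fun h => torusAct_injective g (h.trans h0.symm), fun h => by rw [h, h0]⟩
  let φ : SpecialLinearGroup (Fin d) ℤ →* Equiv.Perm T :=
    MonoidHom.mk' (fun g => Equiv.Perm.subtypePerm (torusPerm g) (hT g))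
      fun g h => Equiv.ext fun y => Subtype.ext (torusAct_mul g h y.1)
  refine ⟨Nat.card (Equiv.Perm T) - 1, fun g y hy => ?_⟩
  rw [Nat.sub_add_cancel Nat.card_pos]
  have h1 : φ (g ^ Nat.card (Equiv.Perm T)) = 1 := by rw [map_pow, pow_card_eq_one']
  exact congrArg Subtype.val (Equiv.congr_fun h1 ⟨y, hy⟩)

end TorusWalk

namespace TorusWalk

variable {d : ℕ} {μ : PMF (SpecialLinearGroup (Fin d) ℤ)} {χ : semigroup μ → ℝ}
  {ν : Measure (UnitAddTorus (Fin d) × ℝ)}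

/-- The orbit of a rational point is finite, contains the point, and is permuted by the semigroup;
a common power of all elements of the semigroup acts trivially on it. -/
lemma torusOrbit_of_isRationalPoint {x : UnitAddTorus (Fin d)} (hx : IsRationalPoint x) :
    (torusOrbit (semigroup μ) x).Finite ∧ x ∈ torusOrbit (semigroup μ) x ∧
    (∀ g ∈ semigroup μ, ∀ y,
      torusAct g y ∈ torusOrbit (semigroup μ) x ↔ y ∈ torusOrbit (semigroup μ) x) ∧
    ∃ n : ℕ, ∀ g, ∀ y ∈ torusOrbit (semigroup μ) x, torusAct (g ^ (n + 2)) y = y := by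
  obtain ⟨N, hN, hNx⟩ := exists_torsion_of_isRationalPoint hx
  obtain ⟨n, hn⟩ := exists_pow_fixing_torsion (d := d) hN
  have htors : ∀ (g : SpecialLinearGroup (Fin d) ℤ) {y : UnitAddTorus (Fin d)}, N • y = 0 →
      N • torusAct g y = 0 := by
    intro g y hy
    rw [← torusAct_smul, hy]
    funext i
    simp [torusAct]
  have hsub : ∀ y ∈ torusOrbit (semigroup μ) x, N • y = 0 := by
    rintro _ ⟨g, -, rfl⟩
    exact htors g hNx
  have hpow : ∀ g ∈ semigroup μ, ∀ k : ℕ, g ^ (k + 1) ∈ semigroup μ := by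
    intro g hg k
    induction k with
    | zero => simpa using hg
    | succ k ih =>
      rw [pow_succ]
      exact mul_mem ih hg
  refine ⟨(finite_torsion_torus hN).subset hsub, ?_, fun g hg y => ⟨?_, ?_⟩, 2 * n, ?_⟩
  · obtain ⟨g, hg⟩ := semigroup_nonempty μ
    exact ⟨_, hpow g hg n, (hn g x hNx).symm⟩
  · rintro ⟨h, hh, hy⟩
    have hy0 : N • y = 0 := by
      have h1 := htors g⁻¹ (htors h hNx)
      rwa [← hy, ← torusAct_mul, inv_mul_cancel, torusAct_one] at h1
    -- `g ^ n` undoes `g` on torsion points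
    have hyn : y = torusAct (g ^ n * h) x := by
      rw [torusAct_mul, ← hy, ← torusAct_mul, ← pow_succ, hn g y hy0]
    refine ⟨g ^ n * h, ?_, hyn⟩
    rcases n with _ | n
    · simpa using hh
    · exact mul_mem (hpow g hg n) hh
  · rintro ⟨h, hh, rfl⟩
    exact ⟨g * h, mul_mem hg hh, (torusAct_mul g h x).symm⟩
  · intro g y hy
    rw [show 2 * n + 2 = (n + 1) + (n + 1) by ring, pow_add, torusAct_mul, hn g y (hsub y hy),
      hn g y (hsub y hy)]

/-! ### Ergodicity -/

lemma IsStationaryRadon.restrict (hν : IsStationaryRadon μ χ ν)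
    {B : Set (UnitAddTorus (Fin d) × ℝ)} (hB : MeasurableSet B)
    (hinv : ∀ g : μ.support, act χ (gen μ g) ⁻¹' B = B) :
    IsStationaryRadon μ χ (ν.restrict B) where
  radon := by
    have := hν.radon
    exact ⟨fun K hK => (Measure.restrict_apply_le _ _).trans_lt hK.measure_lt_top⟩
  stationary := by
    conv_lhs => rw [hν.stationary]
    rw [Measure.restrict_sum _ hB]
    congr 1
    funext g
    rw [Measure.restrict_smul, Measure.restrict_map (measurable_act χ _) hB, hinv g]

/-- An ergodic measure is carried by any invariant set to which it gives positive mass. -/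
lemma IsErgodicStationary.measure_compl_eq_zero (hν : IsErgodicStationary μ χ ν)
    {B : Set (UnitAddTorus (Fin d) × ℝ)} (hB : MeasurableSet B)
    (hinv : ∀ g : μ.support, act χ (gen μ g) ⁻¹' B = B) (hpos : ν B ≠ 0) : ν Bᶜ = 0 := by
  obtain ⟨⟨c, hc⟩, -⟩ := hν.extremal _ _ (hν.toIsStationaryRadon.restrict hB hinv)
    (hν.toIsStationaryRadon.restrict hB.compl fun g => by rw [Set.preimage_compl, hinv g])
    (Measure.restrict_add_restrict_compl hB).symm
  have h1 : (c • ν) B = ν B := by rw [← hc, Measure.restrict_apply_self]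
  have h2 : (c • ν) Bᶜ = 0 := by
    rw [← hc, Measure.restrict_apply hB.compl, Set.compl_inter_self, measure_empty]
  rw [Measure.smul_apply, ENNReal.smul_def, smul_eq_mul] at h1 h2
  refine (mul_eq_zero.1 h2).resolve_left fun h => hpos ?_
  rw [← h1, h, zero_mul]

/-- A nonzero measure on the line for which every half-line or its complement is null is
carried by one point. -/
lemma exists_compl_singleton_null {ρ : Measure ℝ} (hρ : ρ ≠ 0)
    (h : ∀ s, ρ (Set.Iio s) = 0 ∨ ρ (Set.Ici s) = 0) : ∃ t, ρ {t}ᶜ = 0 := by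
  set A : Set ℝ := {s | ρ (Set.Iio s) = 0}
  have hne : A.Nonempty := by
    by_contra hA
    refine hρ (Measure.measure_univ_eq_zero.1 ?_)
    have : ρ (⋃ n : ℕ, Set.Ici (-(n : ℝ))) = 0 :=
      measure_iUnion_null fun n => (h _).resolve_left fun h0 => hA ⟨_, h0⟩
    refine measure_mono_null (fun s _ => ?_) this
    obtain ⟨n, hn⟩ := exists_nat_ge (-s)
    exact Set.mem_iUnion.2 ⟨n, Set.mem_Ici.2 (by linarith)⟩
  have hbdd : BddAbove A := by
    by_contra hA
    rw [not_bddAbove_iff] at hA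
    refine hρ (Measure.measure_univ_eq_zero.1 ?_)
    have : ρ (⋃ n : ℕ, Set.Iio (n : ℝ)) = 0 := measure_iUnion_null fun n => by
      obtain ⟨s, hs, hns⟩ := hA n
      exact measure_mono_null (Set.Iio_subset_Iio hns.le) hs
    refine measure_mono_null (fun s _ => ?_) this
    obtain ⟨n, hn⟩ := exists_nat_gt s
    exact Set.mem_iUnion.2 ⟨n, hn⟩
  refine ⟨sSup A, ?_⟩
  obtain ⟨u, -, hu, hulim⟩ := exists_seq_strictMono_tendsto (sSup A)
  obtain ⟨v, -, hv, hvlim⟩ := exists_seq_strictAnti_tendsto (sSup A)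
  have h1 : ρ (⋃ n, Set.Iio (u n)) = 0 := measure_iUnion_null fun n => by
    obtain ⟨s, hs, hns⟩ := exists_lt_of_lt_csSup hne (hu n)
    exact measure_mono_null (Set.Iio_subset_Iio hns.le) hs
  have h2 : ρ (⋃ n, Set.Ici (v n)) = 0 := measure_iUnion_null fun n =>
    (h _).resolve_left fun h0 => (hv n).not_ge (le_csSup hbdd h0)
  refine measure_mono_null (fun s hs => ?_) (measure_union_null h1 h2)
  rcases lt_or_gt_of_ne hs with hs | hs
  · obtain ⟨n, hn⟩ := (hulim.eventually (lt_mem_nhds hs)).exists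
    exact Or.inl (Set.mem_iUnion.2 ⟨n, hn⟩)
  · obtain ⟨n, hn⟩ := (hvlim.eventually (gt_mem_nhds hs)).exists
    exact Or.inr (Set.mem_iUnion.2 ⟨n, hn.le⟩)

/-- A measure carried by the preimage of a countable set is the sum of its restrictions to the
fibres over that set. -/
lemma measure_eq_tsum_inter_preimage {X Y : Type*} [MeasurableSpace X] [MeasurableSpace Y]
    [MeasurableSingletonClass Y] {m : Measure X} {f : X → Y} (hf : Measurable f) {C : Set Y}
    (hC : C.Countable) (hnull : m (f ⁻¹' C)ᶜ = 0) {A : Set X} (hA : MeasurableSet A) :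
    m A = ∑' y : C, m (A ∩ f ⁻¹' {y.1}) := by
  have := hC.to_subtype
  rw [← measure_iUnion]
  · rw [← measure_inter_conull hnull]
    congr 1
    ext p
    simp
  · intro y z hyz
    refine Set.disjoint_left.2 fun p hy hz => hyz (Subtype.ext ?_)
    exact (hy.2 : f p = y).symm.trans hz.2
  · exact fun y => hA.inter (hf (measurableSet_singleton _))

lemma sum_dirac_apply {X : Type*} [MeasurableSpace X] (C : Set X) {A : Set X}
    (hA : MeasurableSet A) :
    Measure.sum (fun s : C => Measure.dirac (s : X)) A = ∑' s : C, A.indicator 1 (s : X) := by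
  rw [Measure.sum_apply _ hA]
  exact tsum_congr fun s => Measure.dirac_apply' _ hA

/-! ### Characters with discrete image -/

lemma countable_semigroup : Countable (semigroup μ) := by
  have : Function.Injective fun (g : semigroup μ) (i j : Fin d) =>
      ((g : SpecialLinearGroup (Fin d) ℤ) : Matrix (Fin d) (Fin d) ℤ) i j :=
    fun g h hgh => Subtype.ext (Subtype.ext hgh)
  exact this.countable

lemma measure_act_singleton (hμ : μ.support.Finite) (hχ : ∀ g h, χ (g * h) = χ g + χ h)
    (hcent : Centered μ χ) (hν : IsStationaryRadon μ χ ν) (g : semigroup μ)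
    (p : UnitAddTorus (Fin d) × ℝ) : ν {act χ g p} = ν {p} := by
  obtain ⟨y, t⟩ := p
  rw [act, ← Set.singleton_prod_singleton, ← Set.singleton_prod_singleton,
    ← fiber_apply ν _ (measurableSet_singleton _), ← fiber_apply ν _ (measurableSet_singleton _),
    fiber_torusAct hμ hχ hcent hν, Measure.map_apply (measurable_id'.add_const _)
    (measurableSet_singleton _)]
  congr 1
  ext s
  simp

/-- The orbits over a finite orbit `ω` are invariant in both directions when the image of the
character is a group. -/
lemma preimage_orbit (hχ : ∀ g h, χ (g * h) = χ g + χ h) {x : UnitAddTorus (Fin d)}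
    (hx : IsRationalPoint x) {a : ℝ} (ha : Set.range χ = AddSubgroup.zmultiples a)
    {p : UnitAddTorus (Fin d) × ℝ} (hp : p.1 ∈ torusOrbit (semigroup μ) x) (g : semigroup μ) :
    act χ g ⁻¹' orbit χ p = orbit χ p := by
  obtain ⟨-, -, hiff, n, hn⟩ := torusOrbit_of_isRationalPoint (μ := μ) hx
  have hact : ∀ g h q, act χ (g * h) q = act χ g (act χ h q) := by
    rintro g h ⟨y, t⟩
    refine Prod.ext (torusAct_mul _ _ _) ?_
    simp only [act, hχ]
    ring
  have hstep : ∀ (h : semigroup μ) q, q ∈ orbit χ p → act χ h q ∈ orbit χ p := by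
    rintro h _ ⟨k, rfl⟩
    exact ⟨h * k, hact h k p⟩
  refine Set.Subset.antisymm (fun q hq => ?_) fun q hq => hstep g q hq
  have hq1 : q.1 ∈ torusOrbit (semigroup μ) x := by
    obtain ⟨h, hh⟩ := hq
    rw [← hiff g g.2, show torusAct (g : SpecialLinearGroup (Fin d) ℤ) q.1 = (act χ g q).1 from rfl,
      ← hh]
    exact (hiff h h.2 _).2 hp
  -- `g ^ (n + 1) * h ^ (n + 2)` with `χ h = -χ g` acts as the inverse of `g` over `ω`
  obtain ⟨h, hh⟩ : -χ g ∈ Set.range χ := by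
    rw [ha]
    exact neg_mem (ha ▸ Set.mem_range_self g : χ g ∈ (AddSubgroup.zmultiples a : Set ℝ))
  obtain ⟨h1, e1⟩ := character_pow hχ g n
  obtain ⟨h2, e2⟩ := character_pow hχ h (n + 1)
  have key : act χ (⟨g.1 ^ (n + 1), h1⟩ * ⟨h.1 ^ (n + 2), h2⟩) (act χ g q) = q := by
    rw [hact]
    refine Prod.ext ?_ ?_
    · change torusAct (g.1 ^ (n + 1)) (torusAct (h.1 ^ (n + 2)) (torusAct g.1 q.1)) = q.1
      rw [hn h.1 _ ((hiff g g.2 _).2 hq1), ← torusAct_mul, ← pow_succ, hn _ _ hq1]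
    · change q.2 + χ g + χ ⟨h.1 ^ (n + 1 + 1), h2⟩ + χ ⟨g.1 ^ (n + 1), h1⟩ = q.2
      rw [e1, e2, hh]
      push_cast
      ring
  rw [← key]
  exact hstep _ _ hq

/-- When the image of the character is discrete, ergodicity forces the second coordinate to lie in
a single coset of this image, which makes the measure atomic. -/
lemma isUniformOn_orbit (hμ : μ.support.Finite) (hχ : ∀ g h, χ (g * h) = χ g + χ h)
    (hcent : Centered μ χ) (hν : IsErgodicStationary μ χ ν) {x : UnitAddTorus (Fin d)}
    (hx : IsRationalPoint x) (hnull : ν (Prod.fst ⁻¹' torusOrbit (semigroup μ) x)ᶜ = 0) {a : ℝ}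
    (ha : Set.range χ = AddSubgroup.zmultiples a) :
    ∃ p : UnitAddTorus (Fin d) × ℝ, p.1 ∈ torusOrbit (semigroup μ) x ∧
      IsUniformOn ν (orbit χ p) := by
  have := hν.radon
  set ω := torusOrbit (semigroup μ) x with hω
  obtain ⟨hωfin, -, hiff, -⟩ := torusOrbit_of_isRationalPoint (μ := μ) hx
  -- measurable representatives modulo `a ℤ`; for `a = 0` this is the identity, as `s / 0 = 0`
  set π : ℝ → ℝ := fun s => s - ⌊s / a⌋ * a with hπ
  have hπm : Measurable π :=
    measurable_id'.sub ((measurable_from_top.comp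
      (Int.measurable_floor.comp (measurable_id'.div_const a))).mul_const a)
  have hπχ : ∀ (g : semigroup μ) s, π (s + χ g) = π s := by
    intro g s
    have hg : χ g ∈ (AddSubgroup.zmultiples a : Set ℝ) := ha ▸ Set.mem_range_self g
    obtain ⟨k, hk⟩ := hg
    have hk : (k : ℝ) * a = χ g := by simpa using hk
    simp only [hπ]
    rw [← hk]
    rcases eq_or_ne a 0 with rfl | h0
    · simp
    · rw [add_div, mul_div_cancel_right₀ _ h0, Int.floor_add_intCast]
      push_cast
      ring
  have hm : Measurable fun q : UnitAddTorus (Fin d) × ℝ => π q.2 := hπm.comp measurable_snd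
  obtain ⟨t, ht⟩ : ∃ t, ν.map (fun q => π q.2) {t}ᶜ = 0 := by
    refine exists_compl_singleton_null (fun h => hν.ne_zero ?_) fun s => ?_
    · rwa [Measure.map_eq_zero_iff hm.aemeasurable] at h
    · rw [Measure.map_apply hm measurableSet_Iio, Measure.map_apply hm measurableSet_Ici]
      by_cases h0 : ν ((fun q : UnitAddTorus (Fin d) × ℝ => π q.2) ⁻¹' Set.Iio s) = 0
      · exact Or.inl h0
      · right
        have := hν.measure_compl_eq_zero (hm measurableSet_Iio) (fun g => ?_) h0
        · rwa [← Set.preimage_compl, Set.compl_Iio] at this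
        · ext ⟨y, r⟩
          simp only [act, Set.mem_preimage, hπχ]
  rw [Measure.map_apply hm (measurableSet_singleton t).compl] at ht
  have hcount : (π ⁻¹' {t}).Countable := by
    rcases (π ⁻¹' {t}).eq_empty_or_nonempty with h | ⟨s, hs⟩
    · rw [h]
      exact Set.countable_empty
    · refine (Set.countable_range fun k : ℤ => s + k * a).mono fun r hr => ?_
      refine ⟨⌊r / a⌋ - ⌊s / a⌋, ?_⟩
      have : r - ⌊r / a⌋ * a = s - ⌊s / a⌋ * a := (hr : π r = t).trans (hs : π s = t).symm
      push_cast
      linarith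
  obtain ⟨p, ⟨hp1, -⟩, hp⟩ : ∃ p ∈ ω ×ˢ (π ⁻¹' {t}), ν {p} ≠ 0 := by
    by_contra! hcon
    have hC : ν (ω ×ˢ (π ⁻¹' {t})) = 0 := by
      rw [← Set.biUnion_of_singleton (ω ×ˢ (π ⁻¹' {t}))]
      exact (measure_biUnion_null_iff (hωfin.countable.prod hcount)).2 hcon
    refine hν.ne_zero (Measure.measure_univ_eq_zero.1 ?_)
    refine measure_mono_null (fun q _ => ?_) (measure_union_null hC (measure_union_null hnull ht))
    by_cases h1 : q.1 ∈ ω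
    · by_cases h2 : π q.2 = t
      · exact Or.inl ⟨h1, h2⟩
      · exact Or.inr (Or.inr h2)
    · exact Or.inr (Or.inl h1)
  refine ⟨p, hp1, ?_⟩
  have := countable_semigroup (μ := μ)
  have hO : (orbit χ p).Countable := Set.countable_range _
  have hOν : ∀ q ∈ orbit χ p, ν {q} = ν {p} := by
    rintro _ ⟨g, rfl⟩
    exact measure_act_singleton hμ hχ hcent hν.toIsStationaryRadon g p
  have hOnull : ν (id ⁻¹' orbit χ p)ᶜ = 0 := by
    refine hν.measure_compl_eq_zero hO.measurableSet
      (fun g => preimage_orbit hχ hx ha hp1 (gen μ g)) fun h0 => hp ?_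
    obtain ⟨g, hg⟩ := semigroup_nonempty μ
    have hmem : act χ ⟨g, hg⟩ p ∈ orbit χ p := Set.mem_range_self _
    rw [← hOν _ hmem]
    exact measure_mono_null (Set.singleton_subset_iff.2 hmem) h0
  have hfin : ν {p} ≠ ∞ := isCompact_singleton.measure_lt_top.ne
  refine ⟨(ν {p}).toNNReal, ENNReal.toNNReal_pos hp hfin, ?_⟩
  ext A hA
  rw [Measure.smul_apply, ENNReal.smul_def, smul_eq_mul, ENNReal.coe_toNNReal hfin,
    sum_dirac_apply _ hA, measure_eq_tsum_inter_preimage measurable_id hO hOnull hA,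
    ← ENNReal.tsum_mul_left]
  refine tsum_congr fun q => ?_
  by_cases hq : q.1 ∈ A
  · rw [Set.indicator_of_mem hq, Pi.one_apply, mul_one, Set.preimage_id,
      Set.inter_eq_right.2 (Set.singleton_subset_iff.2 hq), hOν _ q.2]
  · rw [Set.indicator_of_notMem hq, mul_zero, Set.preimage_id,
      Set.inter_singleton_eq_empty.2 hq, measure_empty]

/-! ### Characters with dense image -/

/-- A Radon measure on the line with a dense set of periods is a multiple of Lebesgue measure. -/
lemma eq_smul_volume_of_dense_periods {m : Measure ℝ} [IsFiniteMeasureOnCompacts m] {D : Set ℝ}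
    (hD : Dense D) (hper : ∀ a ∈ D, m.map (fun s => s + a) = m) :
    ∃ c : ℝ≥0, m = c • volume := by
  have hm : ∀ a : ℝ, Measurable fun s : ℝ => s + a := fun a => measurable_id'.add_const a
  have hinv : m.IsAddLeftInvariant := by
    refine ⟨fun t => ?_⟩
    have : IsFiniteMeasureOnCompacts (m.map (fun s => t + s)) :=
      Measure.IsFiniteMeasureOnCompacts.map _ (Homeomorph.addLeft t)
    refine Measure.ext_of_integral_eq_on_compactlySupported fun f => ?_
    have hcont : Continuous fun x : ℝ => ∫ s, f (s + x) ∂m := by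
      have h := (continuous_integral_apply_neg_add (μ := m) (g := fun u => f (-u)) (by fun_prop)
        (f.hasCompactSupport.comp_homeomorph (Homeomorph.neg ℝ))).comp continuous_neg
      refine h.congr fun x => ?_
      simp [add_comm]
    have heq : (fun x : ℝ => ∫ s, f (s + x) ∂m) = fun _ => ∫ s, f s ∂m :=
      hcont.ext_on hD continuous_const fun a ha => by
        conv_rhs => rw [← hper a ha]
        rw [integral_map (hm a).aemeasurable (Continuous.aestronglyMeasurable (by fun_prop))]
    rw [integral_map (by fun_prop) (Continuous.aestronglyMeasurable (by fun_prop))]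
    simpa only [add_comm] using congrFun heq t
  exact ⟨_, Measure.isAddLeftInvariant_eq_smul m volume⟩

/-- When the image of the character is dense, a power of every group element fixes the finite orbit,
so that the fibres have a dense set of periods. -/
lemma eq_prod_volume (hμ : μ.support.Finite) (hχ : ∀ g h, χ (g * h) = χ g + χ h)
    (hcent : Centered μ χ) (hν : IsStationaryRadon μ χ ν) {x : UnitAddTorus (Fin d)}
    (hx : IsRationalPoint x) (hpos : 0 < ν ({x} ×ˢ Set.univ))
    (hnull : ν (Prod.fst ⁻¹' torusOrbit (semigroup μ) x)ᶜ = 0) (hdense : Dense (Set.range χ)) :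
    ∃ νω : Measure (UnitAddTorus (Fin d)), IsFiniteMeasure νω ∧
      IsUniformOn νω (torusOrbit (semigroup μ) x) ∧ ν = νω.prod volume := by
  have := hν.radon
  obtain ⟨hωfin, hxω, -, n, hn⟩ := torusOrbit_of_isRationalPoint (μ := μ) hx
  set ω := torusOrbit (semigroup μ) x with hω
  have hfib := fun g y => fiber_torusAct hμ hχ hcent hν g y
  obtain ⟨c, hc⟩ : ∃ c : ℝ≥0, fiber ν x = c • volume := by
    refine eq_smul_volume_of_dense_periods (D := (fun s => ((n : ℝ) + 2) * s) '' Set.range χ) ?_ ?_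
    · have hsurj : Function.Surjective fun s : ℝ => ((n : ℝ) + 2) * s := fun s =>
        ⟨s / (n + 2), by field_simp⟩
      exact hsurj.denseRange.dense_image (by fun_prop) hdense
    · rintro _ ⟨_, ⟨g, rfl⟩, rfl⟩
      obtain ⟨h1, e1⟩ := character_pow hχ g (n + 1)
      have h := hfib ⟨_, h1⟩ x
      rw [e1, hn g.1 x hxω] at h
      conv_rhs => rw [h]
      congr 1
      funext s
      push_cast
      ring
  have hcω : ∀ y ∈ ω, fiber ν y = c • volume := by
    rintro _ ⟨g, hg, rfl⟩
    rw [hfib ⟨g, hg⟩, hc, Measure.map_smul, map_add_right_eq_self]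
  have hc0 : 0 < c := by
    refine pos_iff_ne_zero.2 fun h => hpos.ne' ?_
    rw [← fiber_apply ν x MeasurableSet.univ, hc, h]
    simp
  have := hωfin.to_subtype
  have hfin : IsFiniteMeasure
      (c • Measure.sum fun s : ω => Measure.dirac (s : UnitAddTorus (Fin d))) := by
    have := Fintype.ofFinite ω
    rw [Measure.sum_fintype]
    infer_instance
  refine ⟨_, hfin, ⟨c, hc0, rfl⟩, (Measure.prod_eq fun A B hA hB => ?_).symm⟩
  rw [measure_eq_tsum_inter_preimage measurable_fst hωfin.countable hnull (hA.prod hB),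
    Measure.smul_apply, ENNReal.smul_def, smul_eq_mul, sum_dirac_apply _ hA, mul_right_comm,
    ← ENNReal.tsum_mul_left]
  refine tsum_congr fun y => ?_
  by_cases hy : y.1 ∈ A
  · have : (A ×ˢ B) ∩ Prod.fst ⁻¹' {y.1} = {y.1} ×ˢ B := by
      ext ⟨z, t⟩
      simp only [Set.mem_inter_iff, Set.mem_prod, Set.mem_preimage, Set.mem_singleton_iff]
      exact ⟨fun h => ⟨h.2, h.1.2⟩, fun h => ⟨⟨h.1 ▸ hy, h.2⟩, h.1⟩⟩
    rw [this, ← fiber_apply ν _ hB, hcω _ y.2, Set.indicator_of_mem hy, Pi.one_apply, mul_one]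
    rfl
  · have : (A ×ˢ B) ∩ Prod.fst ⁻¹' {y.1} = ∅ := by
      refine Set.eq_empty_of_forall_notMem fun q hq => hy ?_
      exact (hq.2 : q.1 = y.1) ▸ hq.1.1
    rw [this, measure_empty, Set.indicator_of_notMem hy, mul_zero]

end TorusWalk

theorem mainTheorem5 {d : ℕ} (hd : 2 ≤ d)
    (μ : PMF (Matrix.SpecialLinearGroup (Fin d) ℤ)) (hμ : μ.support.Finite)
    (hirr : TorusWalk.StronglyIrreducible (TorusWalk.semigroup μ))
    (χ : TorusWalk.semigroup μ → ℝ) (hχ : ∀ g h, χ (g * h) = χ g + χ h)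
    (hcent : TorusWalk.Centered μ χ)
    (ν : MeasureTheory.Measure (UnitAddTorus (Fin d) × ℝ))
    (hν : TorusWalk.IsErgodicStationary μ χ ν)
    (x : UnitAddTorus (Fin d)) (hx : 0 < ν ({x} ×ˢ Set.univ)) :
    TorusWalk.IsRationalPoint x ∧
    (TorusWalk.torusOrbit (TorusWalk.semigroup μ) x).Finite ∧
    (IsDiscrete (Set.range χ) ∨ Dense (Set.range χ)) ∧
    (IsDiscrete (Set.range χ) →
      ∃ (t : ℝ) (p : UnitAddTorus (Fin d) × ℝ),
        TorusWalk.orbit χ p ⊆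
          TorusWalk.torusOrbit (TorusWalk.semigroup μ) x ×ˢ ((fun s => s + t) '' Set.range χ) ∧
        TorusWalk.IsUniformOn ν (TorusWalk.orbit χ p)) ∧
    (Dense (Set.range χ) →
      ∃ νω : MeasureTheory.Measure (UnitAddTorus (Fin d)),
        MeasureTheory.IsFiniteMeasure νω ∧
        TorusWalk.IsUniformOn νω (TorusWalk.torusOrbit (TorusWalk.semigroup μ) x) ∧
        ν = νω.prod MeasureTheory.volume) := by
  have hrat := TorusWalk.isRationalPoint_of_atom hd hμ hirr hχ hcent hν.toIsStationaryRadon hx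
  obtain ⟨hfin, hxω, hiff, -⟩ := TorusWalk.torusOrbit_of_isRationalPoint (μ := μ) hrat
  have hnull : ν (Prod.fst ⁻¹' TorusWalk.torusOrbit (TorusWalk.semigroup μ) x)ᶜ = 0 := by
    refine hν.measure_compl_eq_zero (measurable_fst hfin.measurableSet) (fun g => ?_) fun h => ?_
    · ext q
      exact hiff g (TorusWalk.gen μ g).2 q.1
    · exact hx.ne' (MeasureTheory.measure_mono_null (fun q hq => hq.1 ▸ hxω) h)
  have hdich := TorusWalk.range_character_dense_or_zmultiples hχ hcent
  refine ⟨hrat, hfin, ?_, fun hdisc => ?_, fun hdense =>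
    TorusWalk.eq_prod_volume hμ hχ hcent hν.toIsStationaryRadon hrat hx hnull hdense⟩
  · rcases hdich with h | ⟨a, ha⟩
    · exact Or.inr h
    · left
      rw [ha]
      exact SetLike.isDiscrete_iff_discreteTopology.2 inferInstance
  · obtain ⟨a, ha⟩ := hdich.resolve_left fun h => TorusWalk.not_isDiscrete_of_dense h hdisc
    obtain ⟨p, hp, hunif⟩ := TorusWalk.isUniformOn_orbit hμ hχ hcent hν hrat hnull ha
    refine ⟨p.2, p, ?_, hunif⟩
    rintro _ ⟨g, rfl⟩
    exact ⟨(hiff g g.2 _).2 hp, χ g, ⟨g, rfl⟩, add_comm _ _⟩
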